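/- Let $\mathcal H_S,\mathcal H_H,\mathcal H_P,\mathcal H_Q$ be $d$-dimensional Hilbert spaces with fixed orthonormal bases, let $|\Gamma\rangle=\sum_{i}|i\rangle|i\rangle$, let $\sigma$ be a density matrix on $\mathbb C^d$ (a Hamiltonian encoded in a state) and let $L$ be a $d\times d$ matrix with $\|L\|_2=\sqrt{\operatorname{Tr}[L^\dagger L]}=1$. Put $|\psi\rangle=(L\otimes I)|\Gamma\rangle_{PQ}$, $\psi=|\psi\rangle\langle\psi|$, let $\omega=\sigma_H\otimes\psi_{PQ}$ be the program state, and let $$\mathcal L(\rho)=-i[\sigma,\rho]+L\rho L^\dagger-\tfrac12\{L^\dagger L,\rho\},\qquad e^{\mathcal Lt}(\rho)=\sum_{k\ge0}\frac{t^k}{k!}\mathcal L^k(\rho).$$ Consider the following algorithm $\mathcal A_{n,t}$, acting on $S$ and using $n$ copies of $\omega$. For $k=1,\dots,n$: adjoin the $k$-th copy of $\omega$; evolve the joint system $SHPQ$ for the time $\Delta=t/n$ under the fixed Lindbladian $$\mathcal M(X)=-i[\hat H,X]+MXM^\dagger-\tfrac12\{M^\dagger M,X\},\qquad \hat H=\mathsf{SWAP}_{SH}\otimes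 I_{PQ},\qquad M=\tfrac1{\sqrt d}\,(I_{SH}\otimes|\Gamma\rangle\langle\Gamma|_{PQ})(\mathsf{SWAP}_{SP}\otimes I_{HQ}),$$ that is, apply $e^{\mathcal M\Delta}$; then trace out $H,P,Q$. Theorem. For every $d$ there is a constant $C>0$, depending only on $d$, such that for all $\sigma$ and $L$ as above, all $t\ge0$, all $\varepsilon>0$, and every integer $n\ge0$ with $n\ge C\,t^2/\varepsilon$ (so in particular for $n=\lceil C\,t^2/\varepsilon\rceil=O(t^2/\varepsilon)$ copies of $\omega$; for $n=0$, which forces $t=0$, $\mathcal A_{n,t}$ is the identity), $\mathcal A_{n,t}$ is a quantum channel and $$\tfrac12\left\|e^{\mathcal Lt}-\mathcal A_{n,t}\right\|_\diamond\le\varepsilon ,$$ where $\|\mathcal N-\mathcal K\|_\diamond=\sup_{R,\rho_{RS}}\|(\mathcal I_R\otimes\mathcal N)(\rho)-(\mathcal I_R\otimes\mathcal K)(\rho)\|_1$, the supremum being over all finite-dimensional reference systems $R$ and all states $\rho$ of $RS$. -/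

import Mathlib

open scoped Matrix Kronecker ComplexOrder ENNReal

noncomputable section

namespace WML

/-! ### States, norms, superoperators in finite dimension -/

/-- The set of density matrices: positive semidefinite matrices of trace one. -/
def IsDensityMatrix {n : Type*} [Fintype n] (X : Matrix n n ℂ) : Prop :=
  X.PosSemidef ∧ X.trace = 1

/-- The Schatten 1-norm (trace norm) `Tr[(X† X)^{1/2}]`; the matrix square root is taken in the
continuous functional calculus. -/
def traceNorm {n : Type*} [Fintype n] [DecidableEq n] (X : Matrix n n ℂ) : ℝ :=
  (cfc Real.sqrt (Xᴴ * X)).trace.re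

/-- The Schatten 2-norm (Hilbert-Schmidt norm) `Tr[X† X]^{1/2}`. -/
def hsNorm {n : Type*} [Fintype n] (X : Matrix n n ℂ) : ℝ :=
  Real.sqrt (Xᴴ * X).trace.re

/-- Superoperators: linear maps from matrices on one system to matrices on another. -/
abbrev Superop (n m : Type*) : Type _ := Matrix n n ℂ →ₗ[ℂ] Matrix m m ℂ

/-- The action of `id_R ⊗ Φ` on a matrix of the joint system `R S`: apply `Φ` to every block
`⟨r| X |r'⟩`. -/
def ampliation {n m : Type*} (R : Type*) (Φ : Superop n m)
    (X : Matrix (R × n) (R × n) ℂ) : Matrix (R × m) (R × m) ℂ :=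
  Matrix.of fun x y => Φ (Matrix.of fun s s' => X (x.1, s) (y.1, s')) x.2 y.2

/-- Quantum channels: completely positive trace-preserving linear maps. -/
def IsQuantumChannel {n m : Type*} [Fintype n] [Fintype m] (Φ : Superop n m) : Prop :=
  (∀ (r : ℕ) (X : Matrix (Fin r × n) (Fin r × n) ℂ),
      X.PosSemidef → (ampliation (Fin r) Φ X).PosSemidef) ∧
    ∀ X : Matrix n n ℂ, (Φ X).trace = X.trace

/-- The (unnormalized) diamond distance: the supremum, over all finite-dimensional reference
systems `R` and all states `ρ` of `R S`, of the trace distance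
`‖(id_R ⊗ Φ)(ρ) - (id_R ⊗ Ψ)(ρ)‖₁`. It is valued in `[0, ∞]`, so that no boundedness is
presupposed. -/
def diamondDist {n m : Type*} [Fintype n] [Fintype m] [DecidableEq m] (Φ Ψ : Superop n m) :
    ℝ≥0∞ :=
  ⨆ (r : ℕ) (ρ : Matrix (Fin r × n) (Fin r × n) ℂ) (_ : IsDensityMatrix ρ),
    ENNReal.ofReal (traceNorm (ampliation (Fin r) Φ ρ - ampliation (Fin r) Ψ ρ))

/-- The Lindbladian with Hamiltonian `H` and a single Lindblad operator `L`:
`X ↦ -i [H, X] + L X L† - (1/2) {L† L, X}`. -/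
def lindbladian {n : Type*} [Fintype n] (H L : Matrix n n ℂ) : Superop n n where
  toFun X := -Complex.I • (H * X - X * H) + L * X * Lᴴ
    - (1 / 2 : ℂ) • (Lᴴ * L * X + X * (Lᴴ * L))
  map_add' X Y := by
    simp only [mul_add, add_mul, smul_add, smul_sub]
    abel
  map_smul' c X := by
    simp only [Matrix.mul_smul, Matrix.smul_mul, smul_sub, smul_add, RingHom.id_apply,
      smul_comm c]

/-- The exponential series of a linear operator on a finite-dimensional space converges. -/
theorem summable_exp_series_aux {E : Type*} [NormedAddCommGroup E] [NormedSpace ℂ E]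
    [FiniteDimensional ℂ E] (G : E →ₗ[ℂ] E) (t : ℝ) (X : E) :
    Summable fun k : ℕ => ((t : ℂ) ^ k / (k.factorial : ℂ)) • (G ^ k) X := by
  have : CompleteSpace E := FiniteDimensional.complete ℂ E
  let A : E →L[ℂ] E := LinearMap.toContinuousLinearMap G
  have hpow : ∀ (k : ℕ) (Y : E), (A ^ k) Y = (G ^ k) Y := by
    intro k
    induction k with
    | zero => intro Y; rfl
    | succ k ih =>
      intro Y
      rw [pow_succ, pow_succ]
      exact ih (G Y)
  have h := NormedSpace.expSeries_summable' (𝕂 := ℂ) ((t : ℂ) • A)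
  have h2 := h.mapL (ContinuousLinearMap.apply ℂ E X)
  refine h2.congr fun k => ?_
  simp only [ContinuousLinearMap.apply_apply, smul_pow, smul_apply, hpow,
    smul_smul]
  congr 1
  rw [div_eq_mul_inv, mul_comm]

/-- The exponential series of a superoperator converges. -/
theorem summable_exp_series {n : Type*} [Fintype n] (G : Superop n n) (t : ℝ)
    (X : Matrix n n ℂ) :
    Summable fun k : ℕ => ((t : ℂ) ^ k / (k.factorial : ℂ)) • (G ^ k) X :=
  summable_exp_series_aux (E := n → n → ℂ) G t X

/-- `e^{G t}`, given by the series `∑ₖ Gᵏ(X) tᵏ / k!`. -/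
def expSuperop {n : Type*} [Fintype n] (G : Superop n n) (t : ℝ) : Superop n n where
  toFun X := ∑' k : ℕ, ((t : ℂ) ^ k / (k.factorial : ℂ)) • (G ^ k) X
  map_add' X Y := by
    rw [← (summable_exp_series G t X).tsum_add (summable_exp_series G t Y)]
    simp only [map_add, smul_add]
  map_smul' c X := by
    rw [RingHom.id_apply, ← (summable_exp_series G t X).tsum_const_smul c]
    simp only [map_smul, smul_comm c]

/-- Adjoining a system in the state `ω`: the map `X ↦ X ⊗ ω`. -/
def adjoin {n p : Type*} (ω : Matrix p p ℂ) : Superop n (n × p) where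
  toFun X := X ⊗ₖ ω
  map_add' X Y := Matrix.add_kronecker X Y ω
  map_smul' c X := Matrix.smul_kronecker c X ω

/-- Tracing out the second system. -/
def traceOut {n p : Type*} [Fintype p] : Superop (n × p) n where
  toFun X := Matrix.of fun i j => ∑ k, X (i, k) (j, k)
  map_add' X Y := by
    ext i j
    simp [Finset.sum_add_distrib]
  map_smul' c X := by
    ext i j
    simp [Finset.mul_sum]

/-! ### The program state -/

/-- The maximally entangled vector `|Γ⟩ = ∑ᵢ |i⟩|i⟩`. -/
def gammaVec (d : ℕ) : Fin d × Fin d → ℂ := fun x => if x.1 = x.2 then 1 else 0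

/-- The rank-one matrix `|v⟩⟨v|`. -/
def ketbra {n : Type*} (v : n → ℂ) : Matrix n n ℂ := Matrix.vecMulVec v (star v)

/-- The vector `|ψ⟩ = (L ⊗ I)|Γ⟩` of the system `P Q`, which encodes `L`. -/
def lindbladVec {d : ℕ} (L : Matrix (Fin d) (Fin d) ℂ) : Fin d × Fin d → ℂ :=
  (L ⊗ₖ (1 : Matrix (Fin d) (Fin d) ℂ)) *ᵥ gammaVec d

/-- The program register `H P Q`, made of three `d`-dimensional systems. -/
abbrev Prog (d : ℕ) : Type := Fin d × Fin d × Fin d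

/-- The program state `ω = σ ⊗ ψ` of `H P Q`, where `ψ = |ψ⟩⟨ψ|`. -/
def programState {d : ℕ} (σ L : Matrix (Fin d) (Fin d) ℂ) : Matrix (Prog d) (Prog d) ℂ :=
  σ ⊗ₖ ketbra (lindbladVec L)

/-! ### The algorithm, on the joint system `S H P Q` -/

/-- The unitary `SWAP_{S H} ⊗ I_{P Q}`: it maps `|s, h, p, q⟩` to `|h, s, p, q⟩`. -/
def swapSH (d : ℕ) : Matrix (Fin d × Prog d) (Fin d × Prog d) ℂ :=
  Matrix.of fun x y => if x = (y.2.1, y.1, y.2.2.1, y.2.2.2) then 1 else 0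

/-- The unitary `SWAP_{S P} ⊗ I_{H Q}`: it maps `|s, h, p, q⟩` to `|p, h, s, q⟩`. -/
def swapSP (d : ℕ) : Matrix (Fin d × Prog d) (Fin d × Prog d) ℂ :=
  Matrix.of fun x y => if x = (y.2.2.1, y.2.1, y.1, y.2.2.2) then 1 else 0

/-- The operator `M = d^{-1/2} (I_{S H} ⊗ |Γ⟩⟨Γ|_{P Q}) (SWAP_{S P} ⊗ I_{H Q})`. -/
def algM (d : ℕ) : Matrix (Fin d × Prog d) (Fin d × Prog d) ℂ :=
  (1 / (Real.sqrt d : ℂ)) •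
    (((1 : Matrix (Fin d) (Fin d) ℂ) ⊗ₖ
        ((1 : Matrix (Fin d) (Fin d) ℂ) ⊗ₖ ketbra (gammaVec d))) * swapSP d)

/-- The fixed Lindbladian that the algorithm runs; it depends on neither `σ` nor `L`. -/
def algGenerator (d : ℕ) : Superop (Fin d × Prog d) (Fin d × Prog d) :=
  lindbladian (swapSH d) (algM d)

/-- One iteration, which consumes one copy of `ω`: adjoin `ω`, evolve under the fixed Lindbladian
for the time `Δ`, trace out the program register. -/
def algStep {d : ℕ} (ω : Matrix (Prog d) (Prog d) ℂ) (Δ : ℝ) : Superop (Fin d) (Fin d) :=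
  traceOut ∘ₗ expSuperop (algGenerator d) Δ ∘ₗ adjoin ω

/-- The algorithm with `n` copies of `ω`: perform `n` iterations, the `k`-th one with the `k`-th
copy, each for the time `Δ = t / n`. -/
def algorithm {d : ℕ} (ω : Matrix (Prog d) (Prog d) ℂ) (t : ℝ) (n : ℕ) :
    Superop (Fin d) (Fin d) :=
  (algStep ω (t / n)) ^ n

end WML

end

open WML

/-! To first order in `Δ`, one iteration is the encoded evolution. Adjoining `ω`, applying the fixed
generator and tracing out gives exactly `lindbladian σ L` (`traceOut_algGenerator_adjoin`): the swap
with `H` turns into multiplication by `σ`, and contracting `ψ` with `⟨Γ|` teleports `L` onto `S`.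
Both exponentials have second-order Taylor remainders, so one iteration and `e^{𝓛Δ}` differ by
`O(Δ²)`, with a constant depending only on `d`, because `σ` and `L` have entries bounded by 1. Over
`n` iterations the errors add up to `n · C (t/n)² = C t²/n ≤ ε`.

The passage to the diamond distance avoids operator norms on ampliations. An entrywise bound `b` on
the Choi matrix of a difference of channels lets that difference be written as `P - Q` with
completely positive parts, by adding and subtracting a small multiple of the depolarizing map. The
traces of `P` and `Q` bound the trace norm uniformly in the reference system (`DiffersBy`). They are
also preserved by channels, which is what makes the errors of successive steps additive.

This needs both evolutions to be channels. Complete positivity of a Lindblad semigroup comes from an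
Euler product whose factors are explicitly in Kraus form, the discrepancy per factor being of second
order. -/

namespace WML

/-! ### Trace norm of a difference of positive matrices -/

/-- The trace norm of a difference of positive semidefinite matrices is at most the sum of their
traces. -/
theorem traceNorm_sub_le {n : Type*} [Fintype n] [DecidableEq n] {P Q : Matrix n n ℂ}
    (hP : P.PosSemidef) (hQ : Q.PosSemidef) :
    traceNorm (P - Q) ≤ (P.trace + Q.trace).re := by
  have hX : (P - Q).IsHermitian := hP.isHermitian.sub hQ.isHermitian
  set X := P - Q with hXdef
  set U : Matrix n n ℂ := (hX.eigenvectorUnitary : Matrix n n ℂ) with hU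
  have hUU : U * Uᴴ = 1 := Unitary.coe_mul_star_self hX.eigenvectorUnitary
  have hUU' : Uᴴ * U = 1 := Unitary.coe_star_mul_self hX.eigenvectorUnitary
  have hdiag : Uᴴ * X * U = Matrix.diagonal (fun i => (hX.eigenvalues i : ℂ)) := by
    have h := hX.spectral_theorem
    rw [Unitary.conjStarAlgAut_apply] at h
    refine (congrArg (fun Y => Uᴴ * Y * U) h).trans ?_
    change Uᴴ * (U * _ * Uᴴ) * U = _
    rw [show ∀ D : Matrix n n ℂ, Uᴴ * (U * D * Uᴴ) * U = (Uᴴ * U) * D * (Uᴴ * U) by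
      intro D; simp only [mul_assoc], hUU']
    simp [Function.comp_def]
  have habs : traceNorm X = ∑ i, |hX.eigenvalues i| := by
    -- For Hermitian `X`, `X† X = X²` and `√(x²) = |x|`, so the trace norm is the sum of the
    -- absolute eigenvalues.
    have hsa : IsSelfAdjoint X := hX
    have h1 : Xᴴ * X = cfc (fun x : ℝ => x ^ 2) X := by
      rw [cfc_pow_id (R := ℝ) X 2, hX.eq, sq]
    have h2 : cfc Real.sqrt (Xᴴ * X) = cfc (fun x : ℝ => |x|) X := by
      rw [h1, ← cfc_comp' Real.sqrt (fun x : ℝ => x ^ 2) X]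
      simp only [Real.sqrt_sq_eq_abs]
    rw [traceNorm, h2, hX.cfc_eq, Matrix.IsHermitian.cfc, Unitary.conjStarAlgAut_apply]
    change (Matrix.trace (U * _ * Uᴴ)).re = _
    rw [Matrix.trace_mul_comm, ← mul_assoc, hUU', one_mul]
    simp [Matrix.trace]
  have htr : ∀ A : Matrix n n ℂ, (Uᴴ * A * U).trace = A.trace := by
    intro A
    rw [Matrix.trace_mul_comm, ← mul_assoc, hUU, one_mul]
  have hP' := hP.conjTranspose_mul_mul_same U
  have hQ' := hQ.conjTranspose_mul_mul_same U
  rw [habs, ← htr P, ← htr Q, Complex.add_re, Matrix.trace, Matrix.trace, Complex.re_sum,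
    Complex.re_sum, ← Finset.sum_add_distrib]
  refine Finset.sum_le_sum fun i _ => ?_
  -- In the eigenbasis of `P - Q` each eigenvalue is a difference of diagonal entries of `P` and
  -- `Q`; these are nonnegative, so its modulus is at most their sum.
  have hi : (Uᴴ * P * U) i i - (Uᴴ * Q * U) i i = (hX.eigenvalues i : ℂ) := by
    have := congrFun (congrFun hdiag i) i
    rw [Matrix.diagonal_apply_eq] at this
    rw [← this, hXdef, mul_sub, sub_mul, Matrix.sub_apply]
  have hi' := congrArg Complex.re hi
  simp only [Complex.sub_re, Complex.ofReal_re] at hi'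
  have h1 := (Complex.le_def.1 (hP'.diag_nonneg (i := i))).1
  have h2 := (Complex.le_def.1 (hQ'.diag_nonneg (i := i))).1
  simp only [Complex.zero_re] at h1 h2
  simp only [Matrix.diag_apply]
  rw [← hi', abs_le]
  constructor <;> linarith

/-! ### Complete positivity, trace preservation and ampliations -/

/-- Complete positivity of a linear map between matrix algebras. -/
def IsCompletelyPositive {n m : Type*} (Φ : Superop n m) : Prop :=
  ∀ (r : ℕ) (X : Matrix (Fin r × n) (Fin r × n) ℂ),
    X.PosSemidef → (ampliation (Fin r) Φ X).PosSemidef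

/-- Preservation of the trace. -/
def IsTracePreserving {n m : Type*} [Fintype n] [Fintype m] (Φ : Superop n m) : Prop :=
  ∀ X : Matrix n n ℂ, (Φ X).trace = X.trace

section Ampliation

variable {n m R : Type*}

theorem ampliation_add_left (Φ Ψ : Superop n m) (X : Matrix (R × n) (R × n) ℂ) :
    ampliation R (Φ + Ψ) X = ampliation R Φ X + ampliation R Ψ X := rfl

theorem ampliation_sub_left (Φ Ψ : Superop n m) (X : Matrix (R × n) (R × n) ℂ) :
    ampliation R (Φ - Ψ) X = ampliation R Φ X - ampliation R Ψ X := rfl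

theorem ampliation_sub_right (Φ : Superop n m) (X Y : Matrix (R × n) (R × n) ℂ) :
    ampliation R Φ (X - Y) = ampliation R Φ X - ampliation R Φ Y := by
  ext x y
  have h : (Matrix.of fun s s' => (X - Y) (x.1, s) (y.1, s') : Matrix n n ℂ) =
      (Matrix.of fun s s' => X (x.1, s) (y.1, s')) -
        Matrix.of fun s s' => Y (x.1, s) (y.1, s') := rfl
  change Φ _ x.2 y.2 = Φ _ x.2 y.2 - Φ _ x.2 y.2
  rw [h, map_sub, Matrix.sub_apply]

theorem IsTracePreserving.trace_ampliation [Fintype n] [Fintype m] [Fintype R]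
    {Φ : Superop n m} (h : IsTracePreserving Φ) (X : Matrix (R × n) (R × n) ℂ) :
    (ampliation R Φ X).trace = X.trace := by
  simp only [Matrix.trace, Fintype.sum_prod_type, Matrix.diag_apply]
  exact Finset.sum_congr rfl fun r _ => h (Matrix.of fun s s' => X (r, s) (r, s'))

end Ampliation

section CompletelyPositive

variable {n m p : Type*}

theorem IsCompletelyPositive.id : IsCompletelyPositive (LinearMap.id : Superop n n) :=
  fun _ _ h => h

theorem IsCompletelyPositive.comp {Φ : Superop m p} {Ψ : Superop n m}
    (hΦ : IsCompletelyPositive Φ) (hΨ : IsCompletelyPositive Ψ) :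
    IsCompletelyPositive (Φ ∘ₗ Ψ) :=
  fun r X hX => hΦ r _ (hΨ r X hX)

theorem IsCompletelyPositive.add {Φ Ψ : Superop n m}
    (hΦ : IsCompletelyPositive Φ) (hΨ : IsCompletelyPositive Ψ) :
    IsCompletelyPositive (Φ + Ψ) :=
  fun r X hX => (hΦ r X hX).add (hΨ r X hX)

theorem IsCompletelyPositive.pow {Φ : Superop n n} (hΦ : IsCompletelyPositive Φ) (k : ℕ) :
    IsCompletelyPositive (Φ ^ k) := by
  induction k with
  | zero => exact .id
  | succ k ih => rw [pow_succ]; exact ih.comp hΦ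

theorem IsTracePreserving.comp [Fintype n] [Fintype m] [Fintype p] {Φ : Superop m p}
    {Ψ : Superop n m} (hΦ : IsTracePreserving Φ) (hΨ : IsTracePreserving Ψ) :
    IsTracePreserving (Φ ∘ₗ Ψ) :=
  fun X => (hΦ _).trans (hΨ X)

theorem IsTracePreserving.pow [Fintype n] {Φ : Superop n n} (hΦ : IsTracePreserving Φ) (k : ℕ) :
    IsTracePreserving (Φ ^ k) := by
  induction k with
  | zero => exact fun _ => rfl
  | succ k ih => rw [pow_succ]; exact ih.comp hΦ

theorem IsQuantumChannel.comp [Fintype n] [Fintype m] [Fintype p] {Φ : Superop m p}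
    {Ψ : Superop n m} (hΦ : IsQuantumChannel Φ) (hΨ : IsQuantumChannel Ψ) :
    IsQuantumChannel (Φ ∘ₗ Ψ) :=
  ⟨IsCompletelyPositive.comp hΦ.1 hΨ.1, IsTracePreserving.comp hΦ.2 hΨ.2⟩

theorem IsQuantumChannel.pow [Fintype n] {Φ : Superop n n} (hΦ : IsQuantumChannel Φ) (k : ℕ) :
    IsQuantumChannel (Φ ^ k) :=
  ⟨IsCompletelyPositive.pow hΦ.1 k, IsTracePreserving.pow hΦ.2 k⟩

/-- The map `X ↦ K X K†`. -/
def conjugation [Fintype n] (K : Matrix m n ℂ) : Superop n m where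
  toFun X := K * X * Kᴴ
  map_add' X Y := by rw [Matrix.mul_add, Matrix.add_mul]
  map_smul' c X := by rw [Matrix.mul_smul, Matrix.smul_mul, RingHom.id_apply]

theorem isCompletelyPositive_conjugation [Fintype n] [Fintype m] (K : Matrix m n ℂ) :
    IsCompletelyPositive (conjugation K) := by
  intro r X hX
  have h : ampliation (Fin r) (conjugation K) X =
      ((1 : Matrix (Fin r) (Fin r) ℂ) ⊗ₖ K) * X * ((1 : Matrix (Fin r) (Fin r) ℂ) ⊗ₖ K)ᴴ := by
    ext ⟨a, i⟩ ⟨b, j⟩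
    simp [ampliation, conjugation, Matrix.mul_apply, Fintype.sum_prod_type,
      Matrix.kroneckerMap_apply, Matrix.one_apply, Finset.sum_ite_eq, apply_ite]
  rw [h]
  exact hX.mul_mul_conjTranspose_same _

/-- Positive semidefiniteness passes to entrywise limits. -/
theorem posSemidef_of_tendsto {n : Type*} [Fintype n] {A : ℕ → Matrix n n ℂ} {B : Matrix n n ℂ}
    (hA : ∀ k, (A k).PosSemidef)
    (h : ∀ i j, Filter.Tendsto (fun k => A k i j) Filter.atTop (nhds (B i j))) :
    B.PosSemidef := by
  refine Matrix.PosSemidef.of_dotProduct_mulVec_nonneg ?_ fun v => ?_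
  · ext i j
    have h1 := (h j i).star
    refine tendsto_nhds_unique (h1.congr fun k => ?_) (h i j)
    exact (hA k).isHermitian.apply i j
  · have h1 : Filter.Tendsto (fun k => star v ⬝ᵥ (A k) *ᵥ v) Filter.atTop
        (nhds (star v ⬝ᵥ B *ᵥ v)) := by
      simp only [dotProduct, Matrix.mulVec]
      exact tendsto_finsetSum _ fun i _ => (tendsto_finsetSum _ fun j _ =>
        (h i j).mul_const _).const_mul _
    exact ge_of_tendsto' h1 fun k => (hA k).dotProduct_mulVec_nonneg v

theorem isCompletelyPositive_of_tendsto [Fintype n] [Fintype m] {F : ℕ → Superop n m}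
    {Φ : Superop n m}
    (hF : ∀ k, IsCompletelyPositive (F k))
    (h : ∀ X i j, Filter.Tendsto (fun k => F k X i j) Filter.atTop (nhds (Φ X i j))) :
    IsCompletelyPositive Φ :=
  fun r X hX => posSemidef_of_tendsto (fun k => hF k r X hX) fun _ _ => h _ _ _

theorem isCompletelyPositive_adjoin {ω : Matrix p p ℂ} [Fintype n] [Fintype p]
    (hω : ω.PosSemidef) : IsCompletelyPositive (adjoin ω : Superop n (n × p)) := by
  intro r X hX
  exact (hX.kronecker hω).submatrix (Equiv.prodAssoc (Fin r) n p).symm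

theorem isTracePreserving_adjoin {ω : Matrix p p ℂ} [Fintype n] [Fintype p]
    (hω : ω.trace = 1) : IsTracePreserving (adjoin ω : Superop n (n × p)) := by
  intro X
  exact (Matrix.trace_kronecker X ω).trans (by rw [hω, mul_one])

theorem isCompletelyPositive_traceOut [Fintype p] :
    IsCompletelyPositive (traceOut : Superop (n × p) n) := by
  intro r X hX
  have h : ampliation (Fin r) (traceOut : Superop (n × p) n) X =
      ∑ k : p, X.submatrix (fun x : Fin r × n => (x.1, (x.2, k)))
        (fun x : Fin r × n => (x.1, (x.2, k))) := by
    ext x y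
    simp [ampliation, traceOut, Matrix.sum_apply]
  rw [h]
  exact Matrix.posSemidef_sum _ fun k _ => hX.submatrix _

theorem isTracePreserving_traceOut [Fintype n] [Fintype p] :
    IsTracePreserving (traceOut : Superop (n × p) n) := by
  intro X
  simp [Matrix.trace, traceOut, Fintype.sum_prod_type]

end CompletelyPositive

/-! ### Choi matrices and the positive decomposition of a difference of channels -/

section Choi

variable {n m : Type*}

/-- The Choi matrix `∑ᵢⱼ Eᵢⱼ ⊗ Φ(Eᵢⱼ)`. -/
def choi [DecidableEq n] (Φ : Superop n m) : Matrix (n × m) (n × m) ℂ :=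
  Matrix.of fun x y => Φ (Matrix.single x.1 y.1 1) x.2 y.2

theorem ampliation_apply_eq_sum [Fintype n] [DecidableEq n] {R : Type*} (Φ : Superop n m)
    (X : Matrix (R × n) (R × n) ℂ) (x y : R × m) :
    ampliation R Φ X x y = ∑ i, ∑ j, X (x.1, i) (y.1, j) * choi Φ (i, x.2) (j, y.2) := by
  have h := Matrix.matrix_eq_sum_single (Matrix.of fun s s' => X (x.1, s) (y.1, s'))
  simp only [ampliation, Matrix.of_apply]
  rw [h]
  simp only [map_sum, Matrix.sum_apply, Matrix.of_apply, choi]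
  refine Finset.sum_congr rfl fun i _ => Finset.sum_congr rfl fun j _ => ?_
  rw [show (Matrix.single i j (X (x.1, i) (y.1, j)) : Matrix n n ℂ) =
    X (x.1, i) (y.1, j) • Matrix.single i j 1 by simp, map_smul]
  rfl

/-- A linear map with positive semidefinite Choi matrix is completely positive. -/
theorem isCompletelyPositive_of_choi [Fintype n] [DecidableEq n] [Fintype m] [DecidableEq m]
    {Φ : Superop n m} (h : (choi Φ).PosSemidef) : IsCompletelyPositive Φ := by
  intro r X hX
  -- `V` contracts the input leg of `X` with the input leg of the Choi matrix, so the ampliation is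
  -- a compression of a positive tensor product.
  let V : Matrix (Fin r × m) ((Fin r × n) × (n × m)) ℂ :=
    Matrix.of fun x y => if x.1 = y.1.1 ∧ x.2 = y.2.2 ∧ y.1.2 = y.2.1 then 1 else 0
  have hV : ampliation (Fin r) Φ X = V * (X ⊗ₖ choi Φ) * Vᴴ := by
    ext ⟨a, k⟩ ⟨b, l⟩
    rw [ampliation_apply_eq_sum]
    simp only [V, Matrix.mul_apply, Fintype.sum_prod_type, Matrix.of_apply,
      Matrix.conjTranspose_apply, Matrix.kroneckerMap_apply, ite_and, apply_ite star, star_one,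
      star_zero, ite_mul, one_mul, zero_mul, mul_ite, mul_one, mul_zero, Finset.sum_ite_eq,
      Finset.mem_univ, if_true, Finset.sum_ite_irrel, Finset.sum_const_zero]
    rw [Finset.sum_comm]
  rw [hV]
  exact (hX.kronecker h).mul_mul_conjTranspose_same V

/-- The Choi matrix is the ampliation evaluated at the positive matrix `|Γ⟩⟨Γ|`. -/
theorem IsCompletelyPositive.posSemidef_choi {d : ℕ} {Φ : Superop (Fin d) m}
    (h : IsCompletelyPositive Φ) : (choi Φ).PosSemidef := by
  have h1 := h d (ketbra (gammaVec d)) (Matrix.posSemidef_vecMulVec_self_star _)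
  convert h1 using 1
  ext x y
  refine congrFun (congrFun (congrArg (fun Y => Φ Y) ?_) _) _
  ext i j
  by_cases hx : x.1 = i <;> by_cases hy : y.1 = j <;>
    simp [ketbra, gammaVec, Matrix.vecMulVec_apply, hx, hy]

/-- A Hermitian matrix becomes positive semidefinite after adding a multiple of the identity
that dominates its entries. -/
theorem posSemidef_add_smul_one {n : Type*} [Fintype n] [DecidableEq n] {J : Matrix n n ℂ}
    (hJ : J.IsHermitian) {b : ℝ} (hb : ∀ x y, ‖J x y‖ ≤ b) :
    (J + ((b * Fintype.card n : ℝ) : ℂ) • (1 : Matrix n n ℂ)).PosSemidef := by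
  have hH : (((b * Fintype.card n : ℝ) : ℂ) • (1 : Matrix n n ℂ)).IsHermitian := by
    rw [Matrix.IsHermitian, Matrix.conjTranspose_smul, Matrix.conjTranspose_one]
    simp
  refine Matrix.PosSemidef.of_dotProduct_mulVec_nonneg (hJ.add hH) fun v => ?_
  have him : (star v ⬝ᵥ J *ᵥ v).im = 0 := by
    have := hJ.im_star_dotProduct_mulVec_self v
    simpa using this
  -- Entrywise domination and Cauchy–Schwarz in the form `(∑ |v x|)² ≤ card · ∑ |v x|²` bound the
  -- quadratic form.
  have hnorm : ‖star v ⬝ᵥ J *ᵥ v‖ ≤ b * Fintype.card n * ∑ x, ‖v x‖ ^ 2 := by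
    rcases isEmpty_or_nonempty n with hn | ⟨⟨x₀⟩⟩
    · simp
    have hb0 : 0 ≤ b := (norm_nonneg _).trans (hb x₀ x₀)
    calc ‖star v ⬝ᵥ J *ᵥ v‖ ≤ ∑ x, ∑ y, ‖v x‖ * (b * ‖v y‖) := by
          simp only [dotProduct, Matrix.mulVec, Finset.mul_sum]
          refine (norm_sum_le _ _).trans (Finset.sum_le_sum fun x _ =>
            (norm_sum_le _ _).trans (Finset.sum_le_sum fun y _ => ?_))
          rw [norm_mul, norm_mul, Pi.star_apply, norm_star]
          gcongr
          exact hb x y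
      _ = b * (∑ x, ‖v x‖) ^ 2 := by
          rw [sq, Finset.sum_mul_sum, Finset.mul_sum]
          refine Finset.sum_congr rfl fun x _ => ?_
          rw [Finset.mul_sum]
          refine Finset.sum_congr rfl fun y _ => by ring
      _ ≤ b * (Fintype.card n * ∑ x, ‖v x‖ ^ 2) := by
          gcongr
          exact sq_sum_le_card_mul_sum_sq
      _ = _ := by ring
  have hvv : star v ⬝ᵥ v = ((∑ x, ‖v x‖ ^ 2 : ℝ) : ℂ) := by
    simp only [dotProduct, Pi.star_apply, Complex.ofReal_sum]
    refine Finset.sum_congr rfl fun x _ => ?_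
    rw [RCLike.star_def, Complex.conj_mul', Complex.ofReal_pow]
  rw [Matrix.add_mulVec, dotProduct_add, Matrix.smul_mulVec, Matrix.one_mulVec, dotProduct_smul,
    hvv, smul_eq_mul, ← Complex.ofReal_mul, Complex.le_def]
  have hre := (abs_le.1 ((Complex.abs_re_le_norm _).trans hnorm)).1
  constructor
  · simp only [Complex.zero_re, Complex.add_re, Complex.ofReal_re]
    linarith
  · simp only [Complex.zero_im, Complex.add_im, Complex.ofReal_im, him, add_zero]

/-- The completely depolarizing map `X ↦ Tr[X] I`. -/
def depolarizing [Fintype n] [DecidableEq m] : Superop n m where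
  toFun X := X.trace • 1
  map_add' X Y := by rw [Matrix.trace_add, add_smul]
  map_smul' c X := by rw [Matrix.trace_smul, RingHom.id_apply, smul_assoc]

theorem choi_depolarizing [Fintype n] [DecidableEq n] [DecidableEq m] :
    choi (depolarizing : Superop n m) = 1 := by
  ext ⟨i, k⟩ ⟨j, l⟩
  by_cases hij : i = j <;> by_cases hkl : k = l <;>
    simp [choi, depolarizing, Matrix.one_apply, hij, hkl, Matrix.trace_single_eq_of_ne]

theorem trace_ampliation_depolarizing [Fintype n] [Fintype m] [DecidableEq m] {R : Type*}
    [Fintype R] (X : Matrix (R × n) (R × n) ℂ) :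
    (ampliation R (depolarizing : Superop n m) X).trace = Fintype.card m * X.trace := by
  simp only [Matrix.trace, Fintype.sum_prod_type, ampliation, depolarizing, LinearMap.coe_mk,
    AddHom.coe_mk, Matrix.of_apply, Matrix.diag_apply, Matrix.smul_apply, Matrix.one_apply_eq,
    smul_eq_mul, mul_one, Finset.sum_const, Finset.card_univ, nsmul_eq_mul, Finset.mul_sum]

/-- The difference of two channels with close Choi matrices, applied to part of a positive matrix,
is a difference of positive matrices of small trace. -/
theorem exists_posSemidef_sub_of_norm_choi_le {d : ℕ} {Φ Ψ : Superop (Fin d) (Fin d)}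
    (hΦ : IsQuantumChannel Φ) (hΨ : IsQuantumChannel Ψ) {b : ℝ} (hb0 : 0 ≤ b)
    (hb : ∀ x y, ‖choi (Φ - Ψ) x y‖ ≤ b) {r : ℕ}
    {X : Matrix (Fin r × Fin d) (Fin r × Fin d) ℂ} (hX : X.PosSemidef) (hX1 : X.trace = 1) :
    ∃ P Q : Matrix (Fin r × Fin d) (Fin r × Fin d) ℂ, P.PosSemidef ∧ Q.PosSemidef ∧
      ampliation (Fin r) Φ X - ampliation (Fin r) Ψ X = P - Q ∧
      (P.trace + Q.trace).re = 2 * d ^ 3 * b := by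
  -- With `c = b d²`, the decomposition is `P = (Φ - Ψ) + c·depolarizing` and `Q = c·depolarizing`,
  -- applied to `X`. As `Φ - Ψ` annihilates the trace, each of `P`, `Q` has trace `c d = b d³`.
  set c : ℂ := ((b * Fintype.card (Fin d × Fin d) : ℝ) : ℂ) with hc
  have hc0 : 0 ≤ c := by
    rw [hc]
    exact_mod_cast mul_nonneg hb0 (Nat.cast_nonneg _)
  have hH : (choi (Φ - Ψ)).IsHermitian :=
    (IsCompletelyPositive.posSemidef_choi hΦ.1).isHermitian.sub
      (IsCompletelyPositive.posSemidef_choi hΨ.1).isHermitian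
  have hT : IsCompletelyPositive (c • (depolarizing : Superop (Fin d) (Fin d))) := by
    refine isCompletelyPositive_of_choi ?_
    have : choi (c • (depolarizing : Superop (Fin d) (Fin d))) = c • 1 := by
      rw [← choi_depolarizing]; rfl
    rw [this]
    exact Matrix.PosSemidef.one.smul hc0
  have hS : IsCompletelyPositive ((Φ - Ψ) + c • (depolarizing : Superop (Fin d) (Fin d))) := by
    refine isCompletelyPositive_of_choi ?_
    have : choi ((Φ - Ψ) + c • (depolarizing : Superop (Fin d) (Fin d))) =
        choi (Φ - Ψ) + c • 1 := by
      rw [← choi_depolarizing]; rfl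
    rw [this]
    exact posSemidef_add_smul_one hH hb
  refine ⟨_, _, hS r X hX, hT r X hX, ?_, ?_⟩
  · rw [ampliation_add_left, ampliation_sub_left, add_sub_cancel_right]
  · have h1 : (ampliation (Fin r) (c • (depolarizing : Superop (Fin d) (Fin d))) X).trace
        = c * d := by
      have : ampliation (Fin r) (c • (depolarizing : Superop (Fin d) (Fin d))) X =
        c • ampliation (Fin r) (depolarizing : Superop (Fin d) (Fin d)) X := rfl
      rw [this, Matrix.trace_smul, trace_ampliation_depolarizing, hX1, smul_eq_mul, mul_one,
        Fintype.card_fin]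
    rw [ampliation_add_left, ampliation_sub_left, Matrix.trace_add, Matrix.trace_sub, h1,
      IsTracePreserving.trace_ampliation hΦ.2, IsTracePreserving.trace_ampliation hΨ.2, sub_self,
      zero_add, hc, Fintype.card_prod, Fintype.card_fin]
    simp only [Complex.add_re, ← Complex.ofReal_natCast, ← Complex.ofReal_mul,
      Complex.ofReal_re]
    push_cast
    ring

end Choi

/-! ### Exponential estimates and Euler's product in a Banach algebra -/

section BanachAlgebra

variable {A : Type*} [NormedRing A] [NormedAlgebra ℂ A] [CompleteSpace A]

/-- After the first two terms are dropped, `1/(k+2)! ≤ 1/k!` lets `‖x‖²` factor out of the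
majorizing series. -/
theorem norm_exp_sub_one_sub_le (x : A) :
    ‖NormedSpace.exp x - 1 - x‖ ≤ ‖x‖ ^ 2 * Real.exp ‖x‖ := by
  have h := NormedSpace.exp_series_hasSum_exp' (𝕂 := ℂ) x
  have h2 := (hasSum_nat_add_iff' 2).2 h
  have hr := (NormedSpace.exp_series_hasSum_exp' (𝕂 := ℝ) (‖x‖)).mul_left (‖x‖ ^ 2)
  rw [← Real.exp_eq_exp_ℝ] at hr
  have he : NormedSpace.exp x - ∑ i ∈ Finset.range 2, ((i.factorial : ℂ)⁻¹) • x ^ i =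
      NormedSpace.exp x - 1 - x := by
    simp [Finset.sum_range_succ, sub_sub]
  rw [← he]
  refine h2.norm_le_of_bounded hr fun k => ?_
  rw [norm_smul, norm_inv, Complex.norm_natCast, smul_eq_mul, pow_add, mul_comm (‖x‖ ^ 2),
    mul_assoc]
  have h3 : ((k + 2).factorial : ℝ)⁻¹ ≤ (k.factorial : ℝ)⁻¹ := by
    gcongr
    omega
  have h4 : ‖x ^ k * x ^ 2‖ ≤ ‖x‖ ^ k * ‖x‖ ^ 2 := by
    rw [← pow_add, ← pow_add]
    exact norm_pow_le' _ (by omega)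
  gcongr

theorem norm_exp_le_exp_norm [NormOneClass A] (x : A) : ‖NormedSpace.exp x‖ ≤ Real.exp ‖x‖ := by
  have h := NormedSpace.exp_series_hasSum_exp' (𝕂 := ℂ) x
  have hr := NormedSpace.exp_series_hasSum_exp' (𝕂 := ℝ) (‖x‖)
  rw [← Real.exp_eq_exp_ℝ] at hr
  refine h.norm_le_of_bounded hr fun k => ?_
  rw [norm_smul, norm_inv, Complex.norm_natCast, smul_eq_mul]
  gcongr
  exact norm_pow_le _ _

/-- Telescoping: the powers differ by `n` terms, each containing one factor `x - y`. The assumption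
`1 ≤ M` allows the exponents to be rounded up. -/
theorem norm_pow_sub_pow_le {A : Type*} [NormedRing A] [NormOneClass A] {x y : A} {M : ℝ}
    (hx : ‖x‖ ≤ M) (hy : ‖y‖ ≤ M) (hM : 1 ≤ M) (n : ℕ) : ‖x ^ n - y ^ n‖ ≤ n * M ^ n * ‖x - y‖ := by
  have hM0 : 0 ≤ M := zero_le_one.trans hM
  induction n with
  | zero => simp
  | succ n ih =>
    have h : x ^ (n + 1) - y ^ (n + 1) = x ^ n * (x - y) + (x ^ n - y ^ n) * y := by
      rw [pow_succ, pow_succ, mul_sub, sub_mul]; abel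
    rw [h]
    calc _ ≤ ‖x‖ ^ n * ‖x - y‖ + n * M ^ n * ‖x - y‖ * ‖y‖ := by
          refine (norm_add_le _ _).trans (add_le_add ?_ ?_)
          · exact (norm_mul_le _ _).trans (by gcongr; exact norm_pow_le _ _)
          · exact (norm_mul_le _ _).trans (by gcongr)
      _ ≤ M ^ (n + 1) * ‖x - y‖ + n * M ^ n * ‖x - y‖ * M := by
          have : ‖x‖ ^ n ≤ M ^ (n + 1) :=
            (pow_le_pow_left₀ (norm_nonneg _) hx n).trans (pow_le_pow_right₀ hM (Nat.le_succ n))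
          gcongr
      _ = _ := by push_cast; ring

/-- Euler's product formula, with a perturbation of second order. -/
theorem tendsto_one_add_add_pow_exp [NormOneClass A] (g q : A) :
    Filter.Tendsto (fun k : ℕ => (1 + ((k : ℂ) + 1)⁻¹ • g + (((k : ℂ) + 1)⁻¹ ^ 2) • q) ^ (k + 1))
      Filter.atTop (nhds (NormedSpace.exp g)) := by
  set K : ℝ := ‖g‖ + ‖q‖ with hK
  set D : ℝ := Real.exp K * (‖g‖ ^ 2 * Real.exp ‖g‖ + ‖q‖) with hD
  have hlim : Filter.Tendsto (fun k : ℕ => D * (1 / ((k : ℝ) + 1))) Filter.atTop (nhds 0) := by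
    simpa using tendsto_one_div_add_atTop_nhds_zero_nat.const_mul D
  rw [tendsto_iff_norm_sub_tendsto_zero]
  refine squeeze_zero (fun _ => norm_nonneg _) (fun k => ?_) hlim
  set s : ℂ := ((k : ℂ) + 1)⁻¹ with hs
  set u : ℝ := ((k : ℝ) + 1)⁻¹ with hu
  have hk : (0 : ℝ) < (k : ℝ) + 1 := by positivity
  have hu0 : 0 ≤ u := by positivity
  have hu1 : u ≤ 1 := inv_le_one_of_one_le₀ (by linarith [Nat.cast_nonneg (α := ℝ) k])
  have hku : ((k + 1 : ℕ) : ℝ) * u = 1 := by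
    rw [hu]; push_cast; exact mul_inv_cancel₀ hk.ne'
  have hsu : ‖s‖ = u := by
    rw [hs, hu, norm_inv]
    congr 1
    exact_mod_cast Complex.norm_natCast (k + 1)
  -- Both the factor and `exp (s • g)` have norm at most `M = e^{K/(k+1)}`, so `M ^ (k + 1) = e^K`
  -- is independent of `k`. The factors differ by `O(1/(k+1)²)`, and telescoping over `k + 1` of
  -- them leaves `D/(k+1)`.
  set M : ℝ := Real.exp (u * K) with hM
  have hK0 : 0 ≤ K := by positivity
  have hM1 : 1 ≤ M := Real.one_le_exp (by positivity)
  have hx : ‖1 + s • g + (s ^ 2) • q‖ ≤ M := by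
    calc _ ≤ 1 + u * ‖g‖ + u ^ 2 * ‖q‖ := by
          refine (norm_add₃_le).trans ?_
          rw [norm_smul, norm_smul, norm_pow, hsu, norm_one]
      _ ≤ 1 + u * K := by
          have : u ^ 2 * ‖q‖ ≤ u * ‖q‖ := by
            gcongr
            nlinarith
          rw [hK]; linarith
      _ ≤ M := by rw [hM]; linarith [Real.add_one_le_exp (u * K)]
  have hsg : ‖s • g‖ = u * ‖g‖ := by rw [norm_smul, hsu]
  have hy : ‖NormedSpace.exp (s • g)‖ ≤ M := by
    refine (norm_exp_le_exp_norm _).trans (Real.exp_le_exp.2 ?_)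
    rw [hsg]
    gcongr
    rw [hK]
    linarith [norm_nonneg q]
  have hexp : NormedSpace.exp g = NormedSpace.exp (s • g) ^ (k + 1) := by
    let : NormedAlgebra ℚ A := NormedAlgebra.restrictScalars ℚ ℂ A
    rw [← NormedSpace.exp_nsmul, ← Nat.cast_smul_eq_nsmul ℂ, smul_smul]
    have : ((k + 1 : ℕ) : ℂ) * s = 1 := by
      rw [hs]; push_cast
      exact mul_inv_cancel₀ (by exact_mod_cast Nat.succ_ne_zero k)
    rw [this, one_smul]
  have hdiff : ‖1 + s • g + (s ^ 2) • q - NormedSpace.exp (s • g)‖ ≤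
      u ^ 2 * (‖g‖ ^ 2 * Real.exp ‖g‖ + ‖q‖) := by
    have h1 : 1 + s • g + (s ^ 2) • q - NormedSpace.exp (s • g) =
        (s ^ 2) • q - (NormedSpace.exp (s • g) - 1 - s • g) := by abel
    rw [h1]
    refine (norm_sub_le _ _).trans ?_
    have h2 := norm_exp_sub_one_sub_le (s • g)
    rw [hsg] at h2
    rw [norm_smul, norm_pow, hsu]
    have h3 : Real.exp (u * ‖g‖) ≤ Real.exp ‖g‖ :=
      Real.exp_le_exp.2 (mul_le_of_le_one_left (norm_nonneg _) hu1)
    have h4 : (u * ‖g‖) ^ 2 * Real.exp (u * ‖g‖) ≤ (u * ‖g‖) ^ 2 * Real.exp ‖g‖ := by gcongr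
    nlinarith
  have hMk : M ^ (k + 1) = Real.exp K := by
    rw [hM, ← Real.exp_nat_mul, ← mul_assoc, hku, one_mul]
  rw [hexp]
  refine (norm_pow_sub_pow_le hx hy hM1 (k + 1)).trans ?_
  rw [hMk]
  calc _ ≤ ((k + 1 : ℕ) : ℝ) * Real.exp K * (u ^ 2 * (‖g‖ ^ 2 * Real.exp ‖g‖ + ‖q‖)) := by gcongr
    _ = (((k + 1 : ℕ) : ℝ) * u) * (D * u) := by rw [hD]; ring
    _ = _ := by rw [hku, one_mul, hu, one_div]

end BanachAlgebra

/-! ### Semigroups of superoperators; Lindblad semigroups are channels -/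

section Semigroup

attribute [local instance] Matrix.normedAddCommGroup Matrix.normedSpace

/-- Superoperators as continuous linear maps. -/
noncomputable def toCLM {n : Type*} [Fintype n] :
    Superop n n ≃ₐ[ℂ] ((n → n → ℂ) →L[ℂ] (n → n → ℂ)) :=
  Module.End.toContinuousLinearMap (n → n → ℂ)

theorem expSuperop_apply {n : Type*} [Fintype n] (G : Superop n n) (t : ℝ) (X : Matrix n n ℂ) :
    expSuperop G t X = NormedSpace.exp ((t : ℂ) • toCLM G) X := by
  have h := (NormedSpace.exp_series_hasSum_exp' (𝕂 := ℂ) ((t : ℂ) • toCLM G)).mapL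
    (ContinuousLinearMap.apply ℂ (n → n → ℂ) X)
  have h2 : HasSum (fun k : ℕ => ((t : ℂ) ^ k / (k.factorial : ℂ)) • (G ^ k) X)
      (NormedSpace.exp ((t : ℂ) • toCLM G) X) := by
    refine h.congr_fun fun k => ?_
    have e : (k.factorial : ℂ)⁻¹ • ((t : ℂ) • toCLM G) ^ k =
        toCLM (((t : ℂ) ^ k / (k.factorial : ℂ)) • G ^ k) := by
      rw [← map_smul, ← map_pow, ← map_smul, smul_pow, smul_smul, div_eq_mul_inv, mul_comm]
    exact (congrArg (fun A : (n → n → ℂ) →L[ℂ] n → n → ℂ => A X) e).symm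
  exact h2.tsum_eq

theorem toCLM_expSuperop {n : Type*} [Fintype n] (G : Superop n n) (t : ℝ) :
    toCLM (expSuperop G t) = NormedSpace.exp ((t : ℂ) • toCLM G) :=
  ContinuousLinearMap.ext fun X => expSuperop_apply G t X

/-- Splits the exact evolution into equal time steps, to be compared one by one with the iterations.
-/
theorem expSuperop_nat_mul {n : Type*} [Fintype n] (G : Superop n n) (t : ℝ) (k : ℕ) :
    expSuperop G (k * t) = expSuperop G t ^ k := by
  let : NormedAlgebra ℚ ((n → n → ℂ) →L[ℂ] (n → n → ℂ)) :=
    NormedAlgebra.restrictScalars ℚ ℂ _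
  apply toCLM.injective
  rw [map_pow, toCLM_expSuperop, toCLM_expSuperop, ← NormedSpace.exp_nsmul,
    ← Nat.cast_smul_eq_nsmul ℂ, smul_smul]
  push_cast
  rfl

theorem norm_expSuperop_sub_le {n : Type*} [Fintype n] (G : Superop n n) {t K : ℝ} (ht : 0 ≤ t)
    (ht1 : t ≤ 1) (hG : ∀ X, ‖G X‖ ≤ K * ‖X‖) (hK : 0 ≤ K) (X : Matrix n n ℂ) :
    ‖expSuperop G t X - X - (t : ℂ) • G X‖ ≤ t ^ 2 * (K ^ 2 * Real.exp K) * ‖X‖ := by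
  have hn : ‖toCLM G‖ ≤ K := ContinuousLinearMap.opNorm_le_bound _ hK hG
  have ht' : ‖(t : ℂ) • toCLM G‖ ≤ t * K := by
    rw [norm_smul, Complex.norm_of_nonneg ht]
    gcongr
  have htK : t * K ≤ K := mul_le_of_le_one_left hK ht1
  have h := norm_exp_sub_one_sub_le ((t : ℂ) • toCLM G)
  have h2 := ContinuousLinearMap.le_of_opNorm_le _ h X
  rw [expSuperop_apply]
  refine h2.trans ?_
  rw [← mul_assoc, ← mul_pow]
  gcongr
  · exact norm_nonneg _
  · exact ht'.trans htK
  · exact le_refl _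

theorem trace_expSuperop {n : Type*} [Fintype n] {G : Superop n n}
    (hG : ∀ X, (G X).trace = 0) (t : ℝ) : IsTracePreserving (expSuperop G t) := by
  intro X
  have h := (summable_exp_series G t X).hasSum.map (Matrix.traceAddMonoidHom n ℂ)
    (Continuous.matrix_trace continuous_id)
  refine h.unique ?_
  -- Every term of the series with `k ≥ 1` lies in the range of `G`, hence is traceless; only the
  -- identity term contributes.
  convert hasSum_single (f := (Matrix.traceAddMonoidHom n ℂ) ∘ fun k : ℕ =>
    ((t : ℂ) ^ k / (k.factorial : ℂ)) • (G ^ k) X) 0 ?_ using 1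
  · simp
  · intro k hk
    obtain ⟨j, rfl⟩ := Nat.exists_eq_succ_of_ne_zero hk
    simp only [Function.comp_apply, Matrix.traceAddMonoidHom_apply, Matrix.trace_smul]
    have h1 : (G ^ (j + 1)) X = G ((G ^ j) X) := by rw [pow_succ']; rfl
    rw [h1, hG, smul_zero]

/-- The dissipative semigroup generated by a Lindbladian consists of quantum channels. -/
theorem isQuantumChannel_expSuperop_lindbladian {n : Type*} [Fintype n] [DecidableEq n]
    {H : Matrix n n ℂ} (hH : H.IsHermitian) (L : Matrix n n ℂ) {t : ℝ} (ht : 0 ≤ t) :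
    IsQuantumChannel (expSuperop (lindbladian H L) t) := by
  refine ⟨?_, trace_expSuperop (fun X => ?_) t⟩
  -- Here `lindbladian H L Y = K Y + Y K† + L Y L†`. With `s = 1/(k+1)`, the Kraus operators `1 + s
  -- t K` and `√(s t) L` give `1 + s t 𝓛 + (s t)² K · K†`, which is an Euler factor up to second
  -- order. Nonnegativity of `t` is needed for the square root.
  · set K : Matrix n n ℂ := -Complex.I • H - (1 / 2 : ℂ) • (Lᴴ * L) with hK
    have hKH : Kᴴ = Complex.I • H - (1 / 2 : ℂ) • (Lᴴ * L) := by
      simp [hK, hH.eq, Matrix.conjTranspose_sub, Matrix.conjTranspose_smul]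
    set F : ℕ → Superop n n := fun k =>
      (conjugation (1 + ((t / (k + 1) : ℝ) : ℂ) • K) +
        conjugation ((Real.sqrt (t / (k + 1)) : ℂ) • L)) ^ (k + 1) with hF
    refine isCompletelyPositive_of_tendsto (F := F) (fun k => IsCompletelyPositive.pow
      ((isCompletelyPositive_conjugation _).add (isCompletelyPositive_conjugation _)) _) ?_
    -- The Euler product is taken in an algebra with `‖1‖ = 1`, which excludes the zero space.
    rcases isEmpty_or_nonempty n with hn | hn
    · exact fun X i => isEmptyElim i
    have hlim := tendsto_one_add_add_pow_exp ((t : ℂ) • toCLM (lindbladian H L))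
      (((t : ℂ) ^ 2) • toCLM (conjugation K))
    intro X i j
    have h1 := ((ContinuousLinearMap.apply ℂ (n → n → ℂ) X).continuous.tendsto _).comp hlim
    have h2 := ((continuous_apply_apply i j).tendsto _).comp h1
    rw [expSuperop_apply]
    refine Filter.Tendsto.congr (fun k => ?_) h2
    have hFk : F k = (1 + ((k : ℂ) + 1)⁻¹ • ((t : ℂ) • lindbladian H L) +
        (((k : ℂ) + 1)⁻¹ ^ 2) • (((t : ℂ) ^ 2) • conjugation K)) ^ (k + 1) := by
      change (_ + _) ^ (k + 1) = _
      congr 1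
      refine LinearMap.ext fun Y => ?_
      set s : ℂ := ((k : ℂ) + 1)⁻¹ with hs
      have ha : ((t / (k + 1) : ℝ) : ℂ) = s * t := by
        rw [hs]; push_cast; rw [div_eq_mul_inv, mul_comm]
      have hb : (Real.sqrt (t / (k + 1)) : ℂ) * (Real.sqrt (t / (k + 1)) : ℂ) = s * t := by
        rw [← Complex.ofReal_mul, Real.mul_self_sqrt (by positivity), ha]
      have hc : star (s * t : ℂ) = s * t := by
        rw [← ha]; exact Complex.conj_ofReal _
      have h3 : conjugation ((Real.sqrt (t / (k + 1)) : ℂ) • L) Y = (s * t) • (L * Y * Lᴴ) := by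
        simp only [conjugation, LinearMap.coe_mk, AddHom.coe_mk, Matrix.conjTranspose_smul,
          Matrix.smul_mul, Matrix.mul_smul, smul_smul]
        rw [← hb]
        congr 2
        exact Complex.conj_ofReal _
      have h4 : conjugation (1 + ((t / (k + 1) : ℝ) : ℂ) • K) Y =
          Y + (s * t) • (K * Y + Y * Kᴴ) + (s * t) ^ 2 • (K * Y * Kᴴ) := by
        rw [ha]
        simp only [conjugation, LinearMap.coe_mk, AddHom.coe_mk, Matrix.conjTranspose_add,
          Matrix.conjTranspose_smul, Matrix.conjTranspose_one, hc, Matrix.add_mul, Matrix.mul_add,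
          Matrix.smul_mul, Matrix.mul_smul, one_mul, mul_one, smul_smul, sq, smul_add]
        abel
      have h5 : lindbladian H L Y = K * Y + Y * Kᴴ + L * Y * Lᴴ := by
        rw [hKH, hK]
        simp only [lindbladian, LinearMap.coe_mk, AddHom.coe_mk, Matrix.sub_mul, Matrix.mul_sub,
          Matrix.smul_mul, Matrix.mul_smul, smul_add, smul_sub, neg_smul, Matrix.neg_mul]
        abel
      rw [LinearMap.add_apply, h3, h4]
      simp only [LinearMap.add_apply, LinearMap.smul_apply, h5, smul_smul, Module.End.one_apply,
        ← mul_pow, conjugation, LinearMap.coe_mk, AddHom.coe_mk]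
      simp only [smul_add]
      abel
    rw [hFk]
    simp only [Function.comp_apply, ← map_smul,
      ← map_pow, ← map_one (toCLM (n := n)), ← map_add]
    rfl
  · simp only [lindbladian, LinearMap.coe_mk, AddHom.coe_mk, Matrix.trace_add, Matrix.trace_sub,
      Matrix.trace_smul]
    rw [Matrix.trace_mul_comm X H, Matrix.trace_mul_comm (L * X), ← mul_assoc,
      Matrix.trace_mul_comm X]
    simp only [sub_self, smul_eq_mul]
    ring

end Semigroup

/-! ### The program state and the first-order identity -/

section Program

variable {d : ℕ}

theorem swapSH_mul_apply (Y : Matrix (Fin d × Prog d) (Fin d × Prog d) ℂ) (s h p q : Fin d)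
    (z : Fin d × Prog d) : (swapSH d * Y) (s, h, p, q) z = Y (h, s, p, q) z := by
  rw [Matrix.mul_apply, Finset.sum_eq_single (h, s, p, q)]
  · simp [swapSH]
  · rintro ⟨a, b, c, e⟩ _ hne
    rw [swapSH, Matrix.of_apply, if_neg, zero_mul]
    intro heq
    simp only [Prod.mk.injEq] at heq
    obtain ⟨rfl, rfl, rfl, rfl⟩ := heq
    exact hne rfl
  · simp

theorem swapSP_mul_apply (Y : Matrix (Fin d × Prog d) (Fin d × Prog d) ℂ) (s h p q : Fin d)
    (z : Fin d × Prog d) : (swapSP d * Y) (s, h, p, q) z = Y (p, h, s, q) z := by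
  rw [Matrix.mul_apply, Finset.sum_eq_single (p, h, s, q)]
  · simp [swapSP]
  · rintro ⟨a, b, c, e⟩ _ hne
    rw [swapSP, Matrix.of_apply, if_neg, zero_mul]
    intro heq
    simp only [Prod.mk.injEq] at heq
    obtain ⟨rfl, rfl, rfl, rfl⟩ := heq
    exact hne rfl
  · simp

theorem isHermitian_swapSH (d : ℕ) : (swapSH d).IsHermitian := by
  refine Matrix.IsHermitian.ext fun x y => ?_
  obtain ⟨s, h, p, q⟩ := x
  obtain ⟨s', h', p', q'⟩ := y
  simp only [swapSH, Matrix.of_apply, Prod.mk.injEq, apply_ite star, star_one, star_zero]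
  congr 1
  simp only [eq_iff_iff]
  constructor <;> rintro ⟨h1, h2, h3, h4⟩ <;> exact ⟨h2.symm, h1.symm, h3.symm, h4.symm⟩

theorem isHermitian_swapSP (d : ℕ) : (swapSP d).IsHermitian := by
  refine Matrix.IsHermitian.ext fun x y => ?_
  obtain ⟨s, h, p, q⟩ := x
  obtain ⟨s', h', p', q'⟩ := y
  simp only [swapSP, Matrix.of_apply, Prod.mk.injEq, apply_ite star, star_one, star_zero]
  congr 1
  simp only [eq_iff_iff]
  constructor <;> rintro ⟨h1, h2, h3, h4⟩ <;> exact ⟨h3.symm, h2.symm, h1.symm, h4.symm⟩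

/-- The operator `I ⊗ |Γ⟩⟨Γ|` on the registers `S H P Q`. -/
def gammaProj (d : ℕ) : Matrix (Fin d × Prog d) (Fin d × Prog d) ℂ :=
  (1 : Matrix (Fin d) (Fin d) ℂ) ⊗ₖ ((1 : Matrix (Fin d) (Fin d) ℂ) ⊗ₖ ketbra (gammaVec d))

theorem gammaProj_mul_apply (Y : Matrix (Fin d × Prog d) (Fin d × Prog d) ℂ) (s h p q : Fin d)
    (z : Fin d × Prog d) :
    (gammaProj d * Y) (s, h, p, q) z = if p = q then ∑ a, Y (s, h, a, a) z else 0 := by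
  rw [Matrix.mul_apply]
  simp only [Fintype.sum_prod_type]
  rw [Fintype.sum_eq_single s, Fintype.sum_eq_single h]
  · simp [gammaProj, Matrix.kroneckerMap_apply, ketbra, gammaVec, Matrix.vecMulVec_apply,
      Finset.sum_ite_irrel]
  · intro b hb
    simp [gammaProj, Matrix.kroneckerMap_apply, Matrix.one_apply_ne hb.symm]
  · intro b hb
    simp [gammaProj, Matrix.kroneckerMap_apply, Matrix.one_apply_ne hb.symm]

theorem isHermitian_gammaProj (d : ℕ) : (gammaProj d).IsHermitian := by
  have h1 : (ketbra (gammaVec d)).IsHermitian :=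
    (Matrix.posSemidef_vecMulVec_self_star (gammaVec d)).isHermitian
  rw [Matrix.IsHermitian, gammaProj, Matrix.conjTranspose_kronecker,
    Matrix.conjTranspose_kronecker, h1.eq, Matrix.conjTranspose_one]

theorem conjTranspose_algM (d : ℕ) :
    (algM d)ᴴ = (1 / (Real.sqrt d : ℂ)) • (swapSP d * gammaProj d) := by
  change ((1 / (Real.sqrt d : ℂ)) • (gammaProj d * swapSP d))ᴴ = _
  rw [Matrix.conjTranspose_smul, Matrix.conjTranspose_mul, (isHermitian_swapSP d).eq,
    (isHermitian_gammaProj d).eq]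
  congr 1
  rw [star_div₀, star_one]
  congr 1
  exact Complex.conj_ofReal _

theorem algM_mul_apply (Y : Matrix (Fin d × Prog d) (Fin d × Prog d) ℂ) (s h p q : Fin d)
    (z : Fin d × Prog d) :
    (algM d * Y) (s, h, p, q) z =
      (1 / (Real.sqrt d : ℂ)) * if p = q then ∑ a, Y (a, h, s, a) z else 0 := by
  change (((1 / (Real.sqrt d : ℂ)) • (gammaProj d * swapSP d)) * Y) (s, h, p, q) z = _
  rw [Matrix.smul_mul, Matrix.smul_apply, mul_assoc, gammaProj_mul_apply, smul_eq_mul]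
  simp only [swapSP_mul_apply]

theorem conjTranspose_algM_mul_apply (Y : Matrix (Fin d × Prog d) (Fin d × Prog d) ℂ)
    (s h p q : Fin d) (z : Fin d × Prog d) :
    ((algM d)ᴴ * Y) (s, h, p, q) z =
      (1 / (Real.sqrt d : ℂ)) * if s = q then ∑ a, Y (p, h, a, a) z else 0 := by
  rw [conjTranspose_algM, Matrix.smul_mul, Matrix.smul_apply, mul_assoc, swapSP_mul_apply,
    gammaProj_mul_apply, smul_eq_mul]

theorem mul_conjTranspose_algM_apply (Y : Matrix (Fin d × Prog d) (Fin d × Prog d) ℂ)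
    (z : Fin d × Prog d) (s h p q : Fin d) :
    (Y * (algM d)ᴴ) z (s, h, p, q) =
      (1 / (Real.sqrt d : ℂ)) * if p = q then ∑ a, Y z (a, h, s, a) else 0 := by
  have h1 : Y * (algM d)ᴴ = (algM d * Yᴴ)ᴴ := by
    rw [Matrix.conjTranspose_mul, Matrix.conjTranspose_conjTranspose]
  have h2 : star (1 / (Real.sqrt d : ℂ)) = 1 / (Real.sqrt d : ℂ) := by
    rw [star_div₀, star_one]
    congr 1
    exact Complex.conj_ofReal _
  rw [h1, Matrix.conjTranspose_apply, algM_mul_apply, star_mul', h2, apply_ite star, star_sum,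
    star_zero]
  simp only [Matrix.conjTranspose_apply, star_star]

theorem inv_sqrt_mul_self (hd : d ≠ 0) :
    (1 / (Real.sqrt d : ℂ)) * (1 / (Real.sqrt d : ℂ)) * d = 1 := by
  have h : (Real.sqrt d : ℂ) * (Real.sqrt d : ℂ) = d := by
    rw [← Complex.ofReal_mul, Real.mul_self_sqrt (Nat.cast_nonneg d), Complex.ofReal_natCast]
  rw [div_mul_div_comm, h, one_mul, one_div, inv_mul_cancel₀ (Nat.cast_ne_zero.2 hd)]

theorem lindbladVec_apply (L : Matrix (Fin d) (Fin d) ℂ) (p q : Fin d) :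
    lindbladVec L (p, q) = L p q := by
  simp [lindbladVec, gammaVec, Matrix.mulVec, dotProduct, Fintype.sum_prod_type,
    Matrix.kroneckerMap_apply, Matrix.one_apply]

theorem programState_apply (σ L : Matrix (Fin d) (Fin d) ℂ) (h p q h' p' q' : Fin d) :
    programState σ L (h, p, q) (h', p', q') = σ h h' * (L p q * star (L p' q')) := by
  simp [programState, Matrix.kroneckerMap_apply, ketbra, Matrix.vecMulVec_apply,
    lindbladVec_apply]

theorem adjoin_programState_apply (σ L X : Matrix (Fin d) (Fin d) ℂ)
    (s h p q s' h' p' q' : Fin d) :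
    (adjoin (programState σ L) X) (s, h, p, q) (s', h', p', q') =
      X s s' * (σ h h' * (L p q * star (L p' q'))) := by
  rw [← programState_apply]
  rfl

theorem sum_sq_norm_of_hsNorm {n : Type*} [Fintype n] {L : Matrix n n ℂ} (hL : hsNorm L = 1) :
    ∑ p, ∑ q, ‖L p q‖ ^ 2 = 1 := by
  rw [hsNorm, Real.sqrt_eq_one] at hL
  rw [← hL, Finset.sum_comm]
  simp only [Matrix.trace, Matrix.diag_apply, Matrix.mul_apply, Matrix.conjTranspose_apply,
    Complex.re_sum]
  refine Finset.sum_congr rfl fun p _ => Finset.sum_congr rfl fun q _ => ?_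
  rw [RCLike.star_def, Complex.conj_mul', ← Complex.ofReal_pow, Complex.ofReal_re]

theorem sum_mul_star_of_hsNorm {n : Type*} [Fintype n] {L : Matrix n n ℂ} (hL : hsNorm L = 1) :
    ∑ p, ∑ q, L p q * star (L p q) = 1 := by
  have h := congrArg (fun x : ℝ => (x : ℂ)) (sum_sq_norm_of_hsNorm hL)
  simp only [Complex.ofReal_sum, Complex.ofReal_one] at h
  rw [← h]
  refine Finset.sum_congr rfl fun p _ => Finset.sum_congr rfl fun q _ => ?_
  rw [RCLike.star_def, Complex.mul_conj', Complex.ofReal_pow]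

theorem traceOut_apply {n p : Type*} [Fintype p] (Y : Matrix (n × p) (n × p) ℂ) (i j : n) :
    (traceOut Y : Matrix n n ℂ) i j = ∑ k, Y (i, k) (j, k) := rfl

theorem traceOut_conjTranspose {n p : Type*} [Fintype p] (Y : Matrix (n × p) (n × p) ℂ) :
    (traceOut Yᴴ : Matrix n n ℂ) = (traceOut Y)ᴴ := by
  ext i j
  simp [traceOut_apply, Matrix.conjTranspose_apply]

theorem adjoin_conjTranspose {n p : Type*} {ω : Matrix p p ℂ} (hω : ω.IsHermitian)
    (X : Matrix n n ℂ) : (adjoin ω X)ᴴ = adjoin ω Xᴴ := by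
  change (X ⊗ₖ ω)ᴴ = Xᴴ ⊗ₖ ω
  rw [Matrix.conjTranspose_kronecker, hω.eq]

theorem posSemidef_programState {σ : Matrix (Fin d) (Fin d) ℂ} (hσ : σ.PosSemidef)
    (L : Matrix (Fin d) (Fin d) ℂ) : (programState σ L).PosSemidef :=
  hσ.kronecker (Matrix.posSemidef_vecMulVec_self_star (lindbladVec L))

theorem trace_programState {σ L : Matrix (Fin d) (Fin d) ℂ} (hσ : σ.trace = 1)
    (hL : hsNorm L = 1) : (programState σ L).trace = 1 := by
  rw [programState, Matrix.trace_kronecker, hσ, one_mul, ← sum_mul_star_of_hsNorm hL]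
  simp [Matrix.trace, ketbra, Matrix.vecMulVec_apply, Fintype.sum_prod_type, lindbladVec_apply]

variable {σ L : Matrix (Fin d) (Fin d) ℂ}

/-- The swap moves the row index of `X` to `H`, where the partial trace contracts it with `σ`; the
factor `ψ` contributes its trace, which is 1. -/
theorem traceOut_swapSH_mul (hL : hsNorm L = 1) (X : Matrix (Fin d) (Fin d) ℂ) :
    traceOut (swapSH d * adjoin (programState σ L) X) = σ * X := by
  ext i j
  simp only [traceOut_apply, Fintype.sum_prod_type, swapSH_mul_apply, adjoin_programState_apply]
  rw [Matrix.mul_apply]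
  refine Finset.sum_congr rfl fun h _ => ?_
  simp only [← Finset.mul_sum]
  rw [sum_mul_star_of_hsNorm hL, mul_one, mul_comm]

theorem traceOut_mul_swapSH (hσ : σ.PosSemidef) (hL : hsNorm L = 1)
    (X : Matrix (Fin d) (Fin d) ℂ) :
    traceOut (adjoin (programState σ L) X * swapSH d) = X * σ := by
  have h := congrArg Matrix.conjTranspose (traceOut_swapSH_mul (σ := σ) hL Xᴴ)
  rw [← traceOut_conjTranspose, Matrix.conjTranspose_mul, (isHermitian_swapSH d).eq,
    adjoin_conjTranspose (posSemidef_programState hσ L).isHermitian, Matrix.conjTranspose_mul,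
    hσ.isHermitian.eq, Matrix.conjTranspose_conjTranspose] at h
  exact h

/-- Gate teleportation: projecting onto `⟨Γ|` after the swap of `S` and `P` applies `L` to `S` and
leaves `d^{-1/2}|Γ⟩` in `P Q`. -/
theorem algM_mul_adjoin_apply (X : Matrix (Fin d) (Fin d) ℂ) (s h p q s' h' p' q' : Fin d) :
    (algM d * adjoin (programState σ L) X) (s, h, p, q) (s', h', p', q') =
      (1 / (Real.sqrt d : ℂ)) *
        if p = q then (L * X) s s' * (σ h h' * star (L p' q')) else 0 := by
  rw [algM_mul_apply]
  simp only [adjoin_programState_apply, Matrix.mul_apply, Finset.sum_mul]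
  congr 2
  refine Finset.sum_congr rfl fun a _ => by ring

/-- Teleportation on both sides leaves `|Γ⟩⟨Γ|/d` in `P Q`, of trace 1: this is what the
normalization `d^{-1/2}` of `algM` is for. -/
theorem traceOut_algM_mul_mul (hd : d ≠ 0) (hσ : σ.trace = 1) (X : Matrix (Fin d) (Fin d) ℂ) :
    traceOut (algM d * adjoin (programState σ L) X * (algM d)ᴴ) = L * X * Lᴴ := by
  ext i j
  simp only [traceOut_apply, Fintype.sum_prod_type, mul_conjTranspose_algM_apply,
    algM_mul_adjoin_apply]
  have h1 : ∀ h p q : Fin d, ((1 / (Real.sqrt d : ℂ)) * if p = q then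
      ∑ a, (1 / (Real.sqrt d : ℂ)) *
        (if p = q then (L * X) i a * (σ h h * star (L j a)) else 0) else 0) =
      if p = q then (1 / (Real.sqrt d : ℂ)) * (1 / (Real.sqrt d : ℂ)) * σ h h *
        (L * X * Lᴴ) i j else 0 := by
    intro h p q
    by_cases hpq : p = q
    · simp only [if_pos hpq]
      rw [Matrix.mul_apply (M := L * X), Finset.mul_sum, Finset.mul_sum]
      refine Finset.sum_congr rfl fun a _ => ?_
      rw [Matrix.conjTranspose_apply]
      ring
    · simp only [if_neg hpq, mul_zero]
  simp only [h1, Finset.sum_ite_eq, Finset.mem_univ, if_true, Finset.sum_const, Finset.card_univ,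
    Fintype.card_fin, nsmul_eq_mul]
  have h2 : ∑ h, σ h h = 1 := hσ
  calc _ = ((1 / (Real.sqrt d : ℂ)) * (1 / (Real.sqrt d : ℂ)) * d) * (∑ h, σ h h) *
        (L * X * Lᴴ) i j := by
        rw [Finset.mul_sum, Finset.sum_mul]
        exact Finset.sum_congr rfl fun h _ => by ring
    _ = _ := by rw [inv_sqrt_mul_self hd, h2, one_mul, one_mul]

/-- Since `⟨Γ|Γ⟩ = d` cancels the prefactor `1/d`, what remains contracts the surviving `⟨ψ|` with
`L X` and produces `L†`. -/
theorem traceOut_conjTranspose_algM_mul_algM_mul (hd : d ≠ 0) (hσ : σ.trace = 1)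
    (X : Matrix (Fin d) (Fin d) ℂ) :
    traceOut ((algM d)ᴴ * algM d * adjoin (programState σ L) X) = Lᴴ * L * X := by
  ext i j
  rw [mul_assoc Lᴴ, mul_assoc (algM d)ᴴ]
  simp only [traceOut_apply, Fintype.sum_prod_type, conjTranspose_algM_mul_apply,
    algM_mul_adjoin_apply, if_true, Finset.sum_const, Finset.card_univ,
    Fintype.card_fin, nsmul_eq_mul, mul_ite, mul_zero, Finset.sum_ite_eq, Finset.mem_univ]
  have h2 : ∑ h, σ h h = 1 := hσ
  have hd' := inv_sqrt_mul_self hd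
  rw [Matrix.mul_apply]
  calc _ = ∑ h, ∑ p, σ h h * (Lᴴ i p * (L * X) p j) := by
        refine Finset.sum_congr rfl fun h _ => Finset.sum_congr rfl fun p _ => ?_
        rw [Matrix.conjTranspose_apply]
        linear_combination ((L * X) p j * σ h h * star (L p i)) * hd'
    _ = _ := by rw [← Finset.sum_mul_sum, h2, one_mul]

theorem traceOut_mul_conjTranspose_algM_mul_algM (hd : d ≠ 0) (hσ : IsDensityMatrix σ)
    (X : Matrix (Fin d) (Fin d) ℂ) :
    traceOut (adjoin (programState σ L) X * ((algM d)ᴴ * algM d)) = X * (Lᴴ * L) := by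
  have h := congrArg Matrix.conjTranspose
    (traceOut_conjTranspose_algM_mul_algM_mul (L := L) hd hσ.2 Xᴴ)
  rw [← traceOut_conjTranspose, Matrix.conjTranspose_mul,
    adjoin_conjTranspose (posSemidef_programState hσ.1 L).isHermitian] at h
  simpa only [Matrix.conjTranspose_mul, Matrix.conjTranspose_conjTranspose] using h

/-- To first order in time, one iteration of the algorithm acts as the encoded Lindbladian. -/
theorem traceOut_algGenerator_adjoin (hd : d ≠ 0) (hσ : IsDensityMatrix σ) (hL : hsNorm L = 1)
    (X : Matrix (Fin d) (Fin d) ℂ) :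
    traceOut (algGenerator d (adjoin (programState σ L) X)) = lindbladian σ L X := by
  simp only [algGenerator, lindbladian, LinearMap.coe_mk, AddHom.coe_mk, map_add, map_sub,
    map_smul, traceOut_swapSH_mul hL, traceOut_mul_swapSH hσ.1 hL, traceOut_algM_mul_mul hd hσ.2,
    traceOut_conjTranspose_algM_mul_algM_mul hd hσ.2,
    traceOut_mul_conjTranspose_algM_mul_algM hd hσ]

theorem traceOut_adjoin {n p : Type*} [Fintype p] {ω : Matrix p p ℂ} (hω : ω.trace = 1)
    (X : Matrix n n ℂ) : traceOut (adjoin ω X) = X := by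
  ext i j
  rw [traceOut_apply]
  change ∑ k, X i j * ω k k = X i j
  rw [← Finset.mul_sum]
  exact (congrArg (X i j * ·) hω).trans (mul_one _)

end Program

/-! ### Entrywise sup-norm estimates and the one-step error -/

section Estimates

attribute [local instance] Matrix.normedAddCommGroup Matrix.normedSpace

variable {n : Type*} [Fintype n]

theorem norm_mul_le_card_mul (A B : Matrix n n ℂ) :
    ‖A * B‖ ≤ Fintype.card n * (‖A‖ * ‖B‖) := by
  rw [Matrix.norm_le_iff (by positivity)]
  intro i j
  rw [Matrix.mul_apply]
  refine (norm_sum_le_of_le (f := fun k => A i k * B k j) _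
    (n := fun _ => ‖A‖ * ‖B‖) fun k _ => ?_).trans ?_
  · rw [norm_mul]
    exact mul_le_mul (Matrix.norm_entry_le_entrywise_sup_norm A)
      (Matrix.norm_entry_le_entrywise_sup_norm B) (norm_nonneg _) (norm_nonneg _)
  · simp

/-- The bound depends on the dimension only, which makes the final constant uniform in `σ` and `L`.
-/
theorem norm_lindbladian_le {H L : Matrix n n ℂ} (hH : ‖H‖ ≤ 1) (hL : ‖L‖ ≤ 1)
    (X : Matrix n n ℂ) :
    ‖lindbladian H L X‖ ≤
      (2 * Fintype.card n + 2 * (Fintype.card n : ℝ) ^ 2) * ‖X‖ := by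
  set N : ℝ := (Fintype.card n : ℝ) with hN
  have hN0 : 0 ≤ N := Nat.cast_nonneg _
  have hX := norm_nonneg X
  have hmul : ∀ {A B : Matrix n n ℂ} {a b : ℝ}, ‖A‖ ≤ a → ‖B‖ ≤ b → 0 ≤ a →
      ‖A * B‖ ≤ N * (a * b) := fun hA hB ha => (norm_mul_le_card_mul _ _).trans
    (mul_le_mul_of_nonneg_left (mul_le_mul hA hB (norm_nonneg _) ha) hN0)
  have hLs : ‖Lᴴ‖ ≤ 1 := by rwa [Matrix.norm_conjTranspose]
  have h1 := hmul hH le_rfl (b := ‖X‖) zero_le_one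
  have h2 := hmul (le_refl ‖X‖) hH hX
  have h3 := hmul (hmul hL (le_refl ‖X‖) zero_le_one) hLs (by positivity)
  have h4 := hmul (hmul hLs hL zero_le_one) (le_refl ‖X‖) (by positivity)
  have h5 := hmul (le_refl ‖X‖) (hmul hLs hL zero_le_one) hX
  have e1 : ‖-Complex.I • (H * X - X * H)‖ ≤ N * (1 * ‖X‖) + N * (‖X‖ * 1) := by
    rw [norm_smul, norm_neg, Complex.norm_I, one_mul]
    exact (norm_sub_le _ _).trans (add_le_add h1 h2)
  have e2 : ‖(1 / 2 : ℂ) • (Lᴴ * L * X + X * (Lᴴ * L))‖ ≤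
      1 / 2 * (N * (N * (1 * 1) * ‖X‖) + N * (‖X‖ * (N * (1 * 1)))) := by
    rw [norm_smul]
    have : ‖(1 / 2 : ℂ)‖ = 1 / 2 := by norm_num
    rw [this]
    gcongr
    exact (norm_add_le _ _).trans (add_le_add h4 h5)
  change ‖-Complex.I • (H * X - X * H) + L * X * Lᴴ
    - (1 / 2 : ℂ) • (Lᴴ * L * X + X * (Lᴴ * L))‖ ≤ _
  refine (norm_sub_le _ _).trans ((add_le_add ((norm_add_le _ _).trans (add_le_add e1 h3))
    e2).trans (le_of_eq ?_))
  ring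

theorem norm_le_one_of_hsNorm {L : Matrix n n ℂ} (hL : hsNorm L = 1) : ‖L‖ ≤ 1 := by
  rw [Matrix.norm_le_iff zero_le_one]
  intro i j
  have h := sum_sq_norm_of_hsNorm hL
  have h1 : ‖L i j‖ ^ 2 ≤ ∑ q, ‖L i q‖ ^ 2 :=
    Finset.single_le_sum (f := fun q => ‖L i q‖ ^ 2) (fun _ _ => by positivity) (Finset.mem_univ j)
  have h2 : ∑ q, ‖L i q‖ ^ 2 ≤ ∑ p, ∑ q, ‖L p q‖ ^ 2 :=
    Finset.single_le_sum (f := fun p => ∑ q, ‖L p q‖ ^ 2) (fun _ _ => by positivity)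
      (Finset.mem_univ i)
  have h3 : ‖L i j‖ ^ 2 ≤ 1 := by linarith
  exact (sq_le_one_iff₀ (norm_nonneg _)).1 h3

theorem IsDensityMatrix.norm_le_one [DecidableEq n] {σ : Matrix n n ℂ} (hσ : IsDensityMatrix σ) :
    ‖σ‖ ≤ 1 := by
  rw [Matrix.norm_le_iff zero_le_one]
  intro i j
  -- Writing `σ = B† B` makes its entries inner products of columns of `B`, whose squared norms sum
  -- to `Tr σ = 1`; then `ab ≤ (a² + b²)/2`.
  obtain ⟨B, hB⟩ : ∃ B : Matrix n n ℂ, σ = Bᴴ * B := by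
    open scoped MatrixOrder Matrix.Norms.L2Operator in
    exact CStarAlgebra.nonneg_iff_eq_star_mul_self.1 hσ.1.nonneg
  have hB1 : hsNorm B = 1 := by rw [hsNorm, ← hB, hσ.2]; simp
  have h := sum_sq_norm_of_hsNorm hB1
  have hk : ∀ k q, ‖B k q‖ ^ 2 ≤ ∑ q, ‖B k q‖ ^ 2 := fun k q =>
    Finset.single_le_sum (f := fun q => ‖B k q‖ ^ 2) (fun _ _ => by positivity)
      (Finset.mem_univ q)
  rw [hB, Matrix.mul_apply, ← h]
  refine norm_sum_le_of_le _ fun k _ => ?_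
  rw [Matrix.conjTranspose_apply, norm_mul, norm_star]
  nlinarith [hk k i, hk k j, sq_nonneg (‖B k i‖ - ‖B k j‖)]

theorem norm_traceOut_le {p : Type*} [Fintype p] (Y : Matrix (n × p) (n × p) ℂ) :
    ‖(traceOut Y : Matrix n n ℂ)‖ ≤ Fintype.card p * ‖Y‖ := by
  rw [Matrix.norm_le_iff (by positivity)]
  intro i j
  rw [traceOut_apply]
  refine (norm_sum_le_of_le _ (n := fun _ => ‖Y‖) fun k _ =>
    Matrix.norm_entry_le_entrywise_sup_norm Y).trans ?_
  simp

theorem norm_adjoin_le {p : Type*} [Fintype p] {ω : Matrix p p ℂ} (hω : ‖ω‖ ≤ 1)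
    (X : Matrix n n ℂ) : ‖adjoin ω X‖ ≤ ‖X‖ := by
  rw [Matrix.norm_le_iff (norm_nonneg _)]
  intro i j
  change ‖X i.1 j.1 * ω i.2 j.2‖ ≤ _
  rw [norm_mul]
  exact (mul_le_mul (Matrix.norm_entry_le_entrywise_sup_norm X)
    ((Matrix.norm_entry_le_entrywise_sup_norm ω).trans hω) (norm_nonneg _) (norm_nonneg _)).trans
    (mul_one _).le

theorem norm_programState_le {d : ℕ} {σ L : Matrix (Fin d) (Fin d) ℂ} (hσ : ‖σ‖ ≤ 1)
    (hL : ‖L‖ ≤ 1) : ‖programState σ L‖ ≤ 1 := by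
  rw [Matrix.norm_le_iff zero_le_one]
  rintro ⟨h, p, q⟩ ⟨h', p', q'⟩
  rw [Matrix.norm_le_iff zero_le_one] at hσ hL
  rw [programState_apply, norm_mul, norm_mul, norm_star]
  exact mul_le_one₀ (hσ _ _) (by positivity) (mul_le_one₀ (hL _ _) (norm_nonneg _) (hL _ _))

/-- For short times, one iteration differs from the exact evolution by a term of second order. -/
theorem exists_norm_choi_sub_le (d : ℕ) : ∃ b : ℝ, 0 ≤ b ∧
    ∀ σ L : Matrix (Fin d) (Fin d) ℂ, IsDensityMatrix σ → hsNorm L = 1 → ∀ t : ℝ, 0 ≤ t → t ≤ 1 →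
      ∀ x y, ‖choi (expSuperop (lindbladian σ L) t - algStep (programState σ L) t) x y‖ ≤
        b * t ^ 2 := by
  set K : ℝ := 2 * d + 2 * (d : ℝ) ^ 2 with hK
  -- The generator run by the algorithm does not involve `σ` or `L`, so its operator norm is a
  -- constant of `d`.
  obtain ⟨K', hK'0, hK'⟩ : ∃ K' : ℝ, 0 ≤ K' ∧ ∀ Y, ‖algGenerator d Y‖ ≤ K' * ‖Y‖ :=
    ⟨‖toCLM (algGenerator d)‖, norm_nonneg _, fun Y => (toCLM (algGenerator d)).le_opNorm Y⟩
  set N : ℝ := (Fintype.card (Prog d) : ℝ) with hN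
  refine ⟨K ^ 2 * Real.exp K + N * (K' ^ 2 * Real.exp K'), by positivity, ?_⟩
  intro σ L hσ hL t ht ht1 x y
  have hd : d ≠ 0 := by
    rintro rfl
    exact x.1.elim0
  have hσn := hσ.norm_le_one
  have hLn := norm_le_one_of_hsNorm hL
  set ω := programState σ L with hω
  set X : Matrix (Fin d) (Fin d) ℂ := Matrix.single x.1 y.1 1 with hX
  have hX1 : ‖X‖ ≤ 1 := by
    rw [Matrix.norm_le_iff zero_le_one]
    intro i j
    rw [hX, Matrix.single_apply]
    split_ifs <;> simp
  have h1 := norm_expSuperop_sub_le (lindbladian σ L) (K := K) ht ht1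
    (fun Y => by simpa [hK] using norm_lindbladian_le hσn hLn Y) (by positivity) X
  have h2 := norm_expSuperop_sub_le (algGenerator d) ht ht1 hK' hK'0 (adjoin ω X)
  have h3 := (norm_traceOut_le _).trans (mul_le_mul_of_nonneg_left h2 (Nat.cast_nonneg _))
  rw [map_sub, map_sub, map_smul, traceOut_algGenerator_adjoin hd hσ hL,
    traceOut_adjoin (trace_programState hσ.2 hL)] at h3
  have h4 : ‖adjoin ω X‖ ≤ 1 :=
    (norm_adjoin_le (norm_programState_le hσn hLn) X).trans hX1
  -- The common part `X + t 𝓛(X)` cancels, leaving the two Taylor remainders.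
  have h5 : choi (expSuperop (lindbladian σ L) t - algStep ω t) x y =
      ((expSuperop (lindbladian σ L) t X - X - (t : ℂ) • lindbladian σ L X) -
        (traceOut (expSuperop (algGenerator d) t (adjoin ω X)) - X -
          (t : ℂ) • lindbladian σ L X)) x.2 y.2 := by
    rw [sub_sub_sub_cancel_right, sub_sub_sub_cancel_right]
    rfl
  rw [h5]
  refine (Matrix.norm_entry_le_entrywise_sup_norm _).trans ((norm_sub_le _ _).trans
    ((add_le_add h1 h3).trans ?_))
  have h6 : t ^ 2 * (K ^ 2 * Real.exp K) * ‖X‖ ≤ t ^ 2 * (K ^ 2 * Real.exp K) :=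
    mul_le_of_le_one_right (by positivity) hX1
  have h7 : N * (t ^ 2 * (K' ^ 2 * Real.exp K') * ‖adjoin ω X‖) ≤
      N * (t ^ 2 * (K' ^ 2 * Real.exp K')) := by
    exact mul_le_mul_of_nonneg_left (mul_le_of_le_one_right (by positivity) h4)
      (Nat.cast_nonneg _)
  linarith

end Estimates

/-! ### Accumulation of errors and the conclusion -/

theorem isQuantumChannel_algStep {d : ℕ} {σ L : Matrix (Fin d) (Fin d) ℂ}
    (hσ : IsDensityMatrix σ) (hL : hsNorm L = 1) {t : ℝ} (ht : 0 ≤ t) :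
    IsQuantumChannel (algStep (programState σ L) t) := by
  have h1 : IsQuantumChannel (adjoin (programState σ L) : Superop (Fin d) (Fin d × Prog d)) :=
    ⟨isCompletelyPositive_adjoin (posSemidef_programState hσ.1 L),
      isTracePreserving_adjoin (trace_programState hσ.2 hL)⟩
  have h2 : IsQuantumChannel (traceOut : Superop (Fin d × Prog d) (Fin d)) :=
    ⟨isCompletelyPositive_traceOut, isTracePreserving_traceOut⟩
  exact h2.comp ((isQuantumChannel_expSuperop_lindbladian (isHermitian_swapSH d) _ ht).comp h1)

/-- `DiffersBy δ Φ Ψ`: applied to part of any state, `Φ` and `Ψ` differ by `P - Q` with positive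
`P` and `Q` of total trace at most `δ`. -/
def DiffersBy {n : Type*} [Fintype n] (δ : ℝ) (Φ Ψ : Superop n n) : Prop :=
  ∀ (r : ℕ) (X : Matrix (Fin r × n) (Fin r × n) ℂ), IsDensityMatrix X →
    ∃ P Q : Matrix (Fin r × n) (Fin r × n) ℂ, P.PosSemidef ∧ Q.PosSemidef ∧
      ampliation (Fin r) Φ X - ampliation (Fin r) Ψ X = P - Q ∧ (P.trace + Q.trace).re ≤ δ

theorem IsQuantumChannel.isDensityMatrix_ampliation {n : Type*} [Fintype n] {Φ : Superop n n}
    (hΦ : IsQuantumChannel Φ) {r : ℕ} {X : Matrix (Fin r × n) (Fin r × n) ℂ}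
    (hX : IsDensityMatrix X) : IsDensityMatrix (ampliation (Fin r) Φ X) :=
  ⟨hΦ.1 r X hX.1, (IsTracePreserving.trace_ampliation hΦ.2 X).trans hX.2⟩

/-- Errors add by the telescoping `Φ^{k+1} - Ψ^{k+1} = (Φ - Ψ)Φ^k + Ψ(Φ^k - Ψ^k)`: `Φ^k` maps states
to states, and `Ψ` preserves positivity and the traces of `P` and `Q`. -/
theorem DiffersBy.pow {n : Type*} [Fintype n] {δ : ℝ} {Φ Ψ : Superop n n}
    (h : DiffersBy δ Φ Ψ) (hΦ : IsQuantumChannel Φ) (hΨ : IsQuantumChannel Ψ) (k : ℕ) :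
    DiffersBy (k * δ) (Φ ^ k) (Ψ ^ k) := by
  induction k with
  | zero => exact fun r X _ => ⟨0, 0, .zero, .zero, by simp, by simp⟩
  | succ k ih =>
    intro r X hX
    obtain ⟨P, Q, hP, hQ, hPQ, ht⟩ := ih r X hX
    obtain ⟨P', Q', hP', hQ', hPQ', ht'⟩ :=
      h r _ ((hΦ.pow k).isDensityMatrix_ampliation hX)
    refine ⟨P' + ampliation (Fin r) Ψ P, Q' + ampliation (Fin r) Ψ Q, hP'.add (hΨ.1 r P hP),
      hQ'.add (hΨ.1 r Q hQ), ?_, ?_⟩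
    · have e1 : ampliation (Fin r) (Φ ^ (k + 1)) X =
          ampliation (Fin r) Φ (ampliation (Fin r) (Φ ^ k) X) := by rw [pow_succ']; rfl
      have e2 : ampliation (Fin r) (Ψ ^ (k + 1)) X =
          ampliation (Fin r) Ψ (ampliation (Fin r) (Ψ ^ k) X) := by rw [pow_succ']; rfl
      rw [e1, e2, add_sub_add_comm, ← ampliation_sub_right, ← hPQ, ← hPQ', ampliation_sub_right,
        sub_add_sub_cancel]
    · rw [Matrix.trace_add, Matrix.trace_add, IsTracePreserving.trace_ampliation hΨ.2,
        IsTracePreserving.trace_ampliation hΨ.2]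
      simp only [Complex.add_re] at ht ht' ⊢
      push_cast
      linarith

theorem DiffersBy.diamondDist_le {n : Type*} [Fintype n] [DecidableEq n] {δ : ℝ}
    {Φ Ψ : Superop n n} (h : DiffersBy δ Φ Ψ) : diamondDist Φ Ψ ≤ ENNReal.ofReal δ := by
  refine iSup_le fun r => iSup_le fun X => iSup_le fun hX => ENNReal.ofReal_le_ofReal ?_
  obtain ⟨P, Q, hP, hQ, hPQ, ht⟩ := h r X hX
  rw [hPQ]
  exact (traceNorm_sub_le hP hQ).trans ht

theorem IsQuantumChannel.differsBy_two {n : Type*} [Fintype n] {Φ Ψ : Superop n n}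
    (hΦ : IsQuantumChannel Φ) (hΨ : IsQuantumChannel Ψ) : DiffersBy 2 Φ Ψ := by
  intro r X hX
  have h1 := hΦ.isDensityMatrix_ampliation hX
  have h2 := hΨ.isDensityMatrix_ampliation hX
  refine ⟨_, _, h1.1, h2.1, rfl, ?_⟩
  rw [h1.2, h2.2]
  norm_num

/-- One iteration of the algorithm has error of second order in time, at all times. -/
theorem exists_differsBy_algStep (d : ℕ) : ∃ C : ℝ, 0 < C ∧
    ∀ σ L : Matrix (Fin d) (Fin d) ℂ, IsDensityMatrix σ → hsNorm L = 1 → ∀ t : ℝ, 0 ≤ t →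
      DiffersBy (C * t ^ 2) (expSuperop (lindbladian σ L) t) (algStep (programState σ L) t) := by
  obtain ⟨b, hb0, hb⟩ := exists_norm_choi_sub_le d
  -- The first summand serves `t ≤ 1`. The extra 2 serves `t > 1`, where the trivial bound 2 on the
  -- difference of two channels is at most `2 t²`.
  refine ⟨2 * d ^ 3 * b + 2, by positivity, fun σ L hσ hL t ht r X hX => ?_⟩
  have hE := isQuantumChannel_expSuperop_lindbladian hσ.1.isHermitian L ht
  have hA := isQuantumChannel_algStep hσ hL ht
  rcases le_or_gt t 1 with ht1 | ht1
  · obtain ⟨P, Q, hP, hQ, hPQ, htr⟩ := exists_posSemidef_sub_of_norm_choi_le hE hA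
      (by positivity) (hb σ L hσ hL t ht ht1) hX.1 hX.2
    refine ⟨P, Q, hP, hQ, hPQ, htr.le.trans ?_⟩
    nlinarith [sq_nonneg t]
  · obtain ⟨P, Q, hP, hQ, hPQ, htr⟩ := hE.differsBy_two hA r X hX
    refine ⟨P, Q, hP, hQ, hPQ, htr.trans ?_⟩
    have h1 : 1 ≤ t ^ 2 := one_le_pow₀ ht1.le
    have h2 : 0 ≤ 2 * (d : ℝ) ^ 3 * b := by positivity
    nlinarith

end WML

theorem theorem2 (d : ℕ) :
    ∃ C : ℝ, 0 < C ∧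
      ∀ σ L : Matrix (Fin d) (Fin d) ℂ, IsDensityMatrix σ → hsNorm L = 1 →
        ∀ t ε : ℝ, 0 ≤ t → 0 < ε →
          ∀ n : ℕ, C * t ^ 2 / ε ≤ n →
            IsQuantumChannel (algorithm (programState σ L) t n) ∧
              (1 / 2) * diamondDist (expSuperop (lindbladian σ L) t)
                (algorithm (programState σ L) t n) ≤ ENNReal.ofReal ε := by
  obtain ⟨C, hC, h⟩ := exists_differsBy_algStep d
  refine ⟨C, hC, fun σ L hσ hL t ε ht hε n hn => ?_⟩
  have hΔ : 0 ≤ t / n := by positivity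
  have hA := isQuantumChannel_algStep hσ hL hΔ
  have hE := isQuantumChannel_expSuperop_lindbladian hσ.1.isHermitian L hΔ
  refine ⟨hA.pow n, ?_⟩
  rw [div_le_iff₀ hε] at hn
  -- For `n = 0`, division by zero gives `t / n = 0`; the hypothesis on `n` then forces `t = 0`, so
  -- `n · (t / n) = t` still holds.
  have ht0 : n = 0 → t = 0 := by
    rintro rfl
    have h1 : C * t ^ 2 ≤ 0 := by simpa using hn
    have h2 : t ^ 2 ≤ 0 := nonpos_of_mul_nonpos_right h1 hC
    exact pow_eq_zero_iff two_ne_zero |>.1 (le_antisymm h2 (sq_nonneg t))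
  have hnt : (n : ℝ) * (t / n) = t := by
    rcases eq_or_ne n 0 with h0 | h0
    · simp [h0, ht0 h0]
    · field_simp
  have hbound : (n : ℝ) * (C * (t / n) ^ 2) ≤ ε := by
    rcases Nat.eq_zero_or_pos n with h0 | h0
    · simp [h0, hε.le]
    · have h0' : (0 : ℝ) < n := Nat.cast_pos.2 h0
      have : (n : ℝ) * (C * (t / n) ^ 2) = C * t ^ 2 / n := by field_simp
      rw [this, div_le_iff₀ h0']
      linarith
  have hD := ((h σ L hσ hL _ hΔ).pow hE hA n).diamondDist_le
  rw [← expSuperop_nat_mul, hnt] at hD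
  -- The factor `1/2` is simply discarded: the full diamond distance is already at most `ε`.
  have hhalf : (1 / 2 : ℝ≥0∞) ≤ 1 := by
    rw [one_div]
    exact ENNReal.inv_le_one.2 one_le_two
  exact (mul_le_of_le_one_left' hhalf).trans (hD.trans (ENNReal.ofReal_le_ofReal hbound))
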